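/- For a subset $S$ of a Euclidean space $\mathbb{R}^d$ and an integer $m\ge 2$, let $\mathrm{Tv}(S,m)$ be the smallest positive integer $n$ such that every multiset of $n$ points of $S$ can be partitioned into $m$ submultisets $A_1,\dots,A_m$ (multiplicities adding up) with $\bigl(\bigcap_{i=1}^m \mathrm{conv}(A_i)\bigr)\cap S\neq\varnothing$; put $\mathrm{Tv}(S,m)=\infty$ if no such $n$ exists. Let the Helly number $\mathrm{He}(S)$ be the smallest positive integer $h$ such that, for every finite family $\mathcal F$ of convex sets in $\mathbb{R}^d$, if $\bigcap\mathcal G$ meets $S$ for every subfamily $\mathcal G\subseteq\mathcal F$ with at most $h$ members, then $\bigcap\mathcal F$ meets $S$; put $\mathrm{He}(S)=\infty$ if no such $h$ exists. Let $m\ge 2$ and $k\ge 1$ be integers. Then: 1. $\mathrm{Tv}(\mathbb{Z}\times\mathbb{R}^k,m)=2(m-1)(k+1)+1$. 2. $\mathrm{Tv}(\mathbb{Z}^2\times\mathbb{R}^k,m)=4(m-1)(k+1)+1$. 3. $\mathrm{Tv}(\mathbb{Z}^3\times\mathbb{R}^k,m)\le 24(m-1)(k+1)-7$. 4. For every integer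 $j\ge 1$, $\;2^j(m-1)(k+1)+1\le \mathrm{Tv}(\mathbb{Z}^j\times\mathbb{R}^k,m)\le j\,2^j(m-1)(k+1)+1$. 5. For every subset $S'\subseteq\mathbb{R}^2$ (in particular every discrete one) with finite Helly number, $\mathrm{Tv}(S'\times\mathbb{R}^k,m)\le \mathrm{He}(S')(m-1)(k+1)+1$. -/

import Mathlib

/-- `HasTverbergPartition S m A`: the multiset `A` can be partitioned (multiplicities adding up) into
`m` submultisets whose convex hulls have a common point that belongs to `S`. -/
def HasTverbergPartition {E : Type*} [AddCommGroup E] [Module ℝ E]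
    (S : Set E) (m : ℕ) (A : Multiset E) : Prop :=
  ∃ P : Fin m → Multiset E, ∑ i, P i = A ∧
    ((⋂ i, convexHull ℝ {x | x ∈ P i}) ∩ S).Nonempty

/-- The Tverberg number `Tv(S, m)`: the smallest positive integer `n` such that every multiset of
`n` points of `S` has an `m`-Tverberg partition over `S`; it is `⊤` if there is no such `n`. -/
noncomputable def tverbergNumber {E : Type*} [AddCommGroup E] [Module ℝ E]
    (S : Set E) (m : ℕ) : ℕ∞ :=
  ⨅ n ∈ {n : ℕ | 0 < n ∧ ∀ A : Multiset E, A.card = n → (∀ x ∈ A, x ∈ S) →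
    HasTverbergPartition S m A}, (n : ℕ∞)

/-- The Helly number `He(S)`: the smallest positive integer `h` such that, for every finite family
`F` of convex sets, if every subfamily with at most `h` members has an intersection meeting `S`,
then the intersection of `F` meets `S`; it is `⊤` if there is no such `h`. -/
noncomputable def hellyNumber {E : Type*} [AddCommGroup E] [Module ℝ E] (S : Set E) : ℕ∞ :=
  ⨅ h ∈ {h : ℕ | 0 < h ∧ ∀ F : Finset (Set E), (∀ C ∈ F, Convex ℝ C) →
    (∀ G ⊆ F, G.card ≤ h → ((⋂ C ∈ G, C) ∩ S).Nonempty) →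
    ((⋂ C ∈ F, C) ∩ S).Nonempty}, (h : ℕ∞)

/-- The integer lattice `ℤ^j` as a subset of `ℝ^j`. -/
def integerLattice (j : ℕ) : Set (Fin j → ℝ) :=
  {x | ∀ i, ∃ z : ℤ, x i = z}

/-- The product `S' × ℝ^k` of a subset `S'` of `ℝ^j` with `ℝ^k`, as a subset of `ℝ^j × ℝ^k`. -/
def prodReal {j : ℕ} (S' : Set (Fin j → ℝ)) (k : ℕ) : Set ((Fin j → ℝ) × (Fin k → ℝ)) :=
  S' ×ˢ Set.univ

/-!
# Tverberg numbers of mixed integer sets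

**Reduction to the discrete factor.** Put `M = (m - 1) * (k + 1) + 1`. If every `N` points of `S'`
can be partitioned into `M` parts whose hulls share a point `p` of `S'`, then `N` points of
`S' × ℝ^k` have an `m`-Tverberg partition: their first coordinates yield `M` parts, each part has a
point `(p, s)` in its hull, and the real Tverberg theorem for the `M` points `s` of `ℝ^k` merges the
parts into `m` classes with a common point `(p, q)` (`tverbergNumber_prodReal_le`). The real theorem
(`exists_tverberg_coloring`) comes from the colourful Carathéodory theorem by Sarkaria's trick.

**Centre points.** What remains is to find a common point in `S'`. A Helly bound `h` for `S'`
yields, among more than `h * (D - 1)` points, a point `p ∈ S'` of depth `D`: every closed half-space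
with `p` on its boundary contains `D` of the points (`IsHellyBound.exists_deep`). For the lattice,
`2 ^ j` is a Helly bound by Doignon's theorem (`isHellyBound_integerLattice`).

**From depth to partitions.** With `p` moved to the origin, the question is how many disjoint
subfamilies have the origin in their hulls.

* In dimension `d`, removing a minimal simplex around the origin lowers the depth by at most `d`, so
  depth `d * s + 1` gives `s + 1` parts (`Deep.splits`). This is the general upper bound.
* In the plane, depth `M` gives `M` parts as soon as there are `3 * M` points (`Deep.splits_plane`):
  points can be omitted until exactly `3 * M` are left, and these are grouped into triangles by
  their angular order. This settles `ℤ^2` and all planar sets with Helly number at least four. With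
  Helly number three, the real Tverberg theorem in the plane suffices, since an extreme point of the
  intersection of the hulls lies in the set (`IsHellyBound.exists_splits_of_le_three`). With a
  smaller Helly number the set lies on a line.
* In space, the last two of the parts come at a smaller price: depth three is enough for two parts,
  provided that there are 37 points (`Deep.splits_two`). The half-spaces with few points all contain
  a common direction `w` in their interiors. In the chart `{f | f w = 1}` of the dual space the
  points become half-planes that cover everything three times, and such a cover decomposes into two
  covers (`exists_complementary_covers`). On the opposite side of the dual space there are enough
  points for two further covers, and a cover from either side together surround the origin.

**Lower bound.** Take the vertices of the product of the unit cube of `ℝ^j` and the standard simplex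
of `ℝ^k`, each `m - 1` times. A common point of the hulls in `ℤ^j × ℝ^k` lies over a vertex of the
cube and has a positive barycentric coordinate, so that some vertex would have to occur in all `m`
parts (`exists_vertex_mem_all`, `le_tverbergNumber_integerLattice`).
-/

/-! ### The origin in the convex hull of a finite family -/

section ZeroHull

open Module

variable {ι E : Type*} [AddCommGroup E] [Module ℝ E]

/-- `ZeroHull x T`: the origin lies in the convex hull of the members of the family `x` whose index
belongs to `T`. -/
def ZeroHull (x : ι → E) (T : Finset ι) : Prop :=
  (0 : E) ∈ convexHull ℝ (x '' (T : Set ι))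

theorem ZeroHull.mono {x : ι → E} {S T : Finset ι} (h : S ⊆ T) (hS : ZeroHull x S) :
    ZeroHull x T :=
  convexHull_mono (Set.image_mono (by exact_mod_cast h)) hS

theorem mem_convexHull_image_of_weights {x : ι → E} {T : Finset ι} {a : ι → ℝ} {p : E}
    (ha : ∀ i ∈ T, 0 ≤ a i) (h1 : ∑ i ∈ T, a i = 1) (hp : ∑ i ∈ T, a i • x i = p) :
    p ∈ convexHull ℝ (x '' (T : Set ι)) := by
  rw [← hp]
  exact (convex_convexHull ℝ _).sum_mem ha h1
    fun i hi => subset_convexHull ℝ _ ⟨i, by exact_mod_cast hi, rfl⟩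

/-- Carathéodory's theorem for indexed families, with positive weights. -/
theorem ZeroHull.exists_pos_weights {x : ι → E} {I : Finset ι} (h : ZeroHull x I) :
    ∃ T ⊆ I, ∃ a : ι → ℝ, (∀ i ∈ T, 0 < a i) ∧ ∑ i ∈ T, a i = 1 ∧ ∑ i ∈ T, a i • x i = 0 ∧
      T.card ≤ finrank ℝ (Submodule.span ℝ (x '' (T : Set ι))) + 1 := by
  classical
  obtain ⟨κ, _, z, w, hz, hind, hw, hw1, hw0⟩ := eq_pos_convex_span_of_mem_convexHull h
  have hg : ∀ k, ∃ i ∈ I, x i = z k := fun k => by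
    obtain ⟨i, hi, he⟩ := hz ⟨k, rfl⟩
    exact ⟨i, by exact_mod_cast hi, he⟩
  choose g hgI hgx using hg
  have hinj : Function.Injective g := fun k l hkl => hind.injective (by rw [← hgx, ← hgx, hkl])
  refine ⟨Finset.univ.image g, ?_, Function.extend g w 0, ?_, ?_, ?_, ?_⟩
  · intro i hi
    obtain ⟨k, -, rfl⟩ := Finset.mem_image.1 hi
    exact hgI k
  · intro i hi
    obtain ⟨k, -, rfl⟩ := Finset.mem_image.1 hi
    rw [hinj.extend_apply]
    exact hw k
  · rw [Finset.sum_image hinj.injOn]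
    simpa [hinj.extend_apply] using hw1
  · rw [Finset.sum_image hinj.injOn]
    simpa [hinj.extend_apply, hgx] using hw0
  · have hset : x '' ((Finset.univ.image g : Finset ι) : Set ι) = Set.range z := by
      ext e
      simp [hgx]
    rw [hset, Finset.card_image_of_injective _ hinj, Finset.card_univ]
    have hle : vectorSpan ℝ (Set.range z) ≤ Submodule.span ℝ (Set.range z) := by
      rw [vectorSpan_def, Submodule.span_le]
      rintro _ ⟨u, hu, v, hv, rfl⟩
      exact Submodule.sub_mem _ (Submodule.subset_span hu) (Submodule.subset_span hv)
    have : FiniteDimensional ℝ (Submodule.span ℝ (Set.range z)) :=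
      FiniteDimensional.span_of_finite ℝ (Set.finite_range z)
    exact hind.card_le_finrank_succ.trans (by gcongr; exact Submodule.finrank_mono hle)

theorem zeroHull_iff_weights {x : ι → E} {T : Finset ι} :
    ZeroHull x T ↔ ∃ a : ι → ℝ, (∀ i ∈ T, 0 ≤ a i) ∧ ∑ i ∈ T, a i = 1 ∧
      ∑ i ∈ T, a i • x i = 0 := by
  classical
  constructor
  · intro h
    obtain ⟨S, hS, a, ha, h1, h0, -⟩ := h.exists_pos_weights
    refine ⟨fun i => if i ∈ S then a i else 0, fun i _ => ?_, ?_, ?_⟩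
    · by_cases hi : i ∈ S
      · simpa [hi] using (ha i hi).le
      · simp [hi]
    · rw [← Finset.sum_filter, Finset.filter_mem_eq_inter, Finset.inter_eq_right.2 hS, h1]
    · simp only [ite_smul, zero_smul]
      rw [← Finset.sum_filter, Finset.filter_mem_eq_inter, Finset.inter_eq_right.2 hS, h0]
  · rintro ⟨a, ha, h1, h0⟩
    exact mem_convexHull_image_of_weights ha h1 h0

theorem ZeroHull.mem_convexHull {x : ι → E} {p : E} {T : Finset ι}
    (h : ZeroHull (fun i => x i - p) T) : p ∈ convexHull ℝ (x '' (T : Set ι)) := by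
  obtain ⟨a, ha, h1, h0⟩ := zeroHull_iff_weights.1 h
  refine mem_convexHull_image_of_weights ha h1 ?_
  simp only [smul_sub, Finset.sum_sub_distrib, ← Finset.sum_smul, h1, one_smul] at h0
  exact sub_eq_zero.1 h0

theorem zeroHull_sub_iff {x : ι → E} {p : E} {T : Finset ι} :
    ZeroHull (fun i => x i - p) T ↔ p ∈ convexHull ℝ (x '' (T : Set ι)) := by
  refine ⟨ZeroHull.mem_convexHull, fun h => ?_⟩
  have himg : (fun i => x i - p) '' (T : Set ι) = (fun y => y + -p) '' (x '' (T : Set ι)) := by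
    rw [Set.image_image]
    simp [sub_eq_add_neg]
  have hc := (convex_convexHull ℝ ((fun i => x i - p) '' (T : Set ι))).translate p
  have hsub : x '' (T : Set ι) ⊆
      (fun z => p + z) '' convexHull ℝ ((fun i => x i - p) '' (T : Set ι)) := by
    rintro _ ⟨i, hi, rfl⟩
    exact ⟨x i - p, subset_convexHull ℝ _ ⟨i, hi, rfl⟩, by simp⟩
  obtain ⟨z, hz, hzp⟩ := convexHull_min hsub hc h
  have : z = 0 := by simpa using hzp
  rwa [this] at hz

theorem ZeroHull.exists_nonneg {x : ι → E} {T : Finset ι} (h : ZeroHull x T) (f : E →ₗ[ℝ] ℝ) :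
    ∃ i ∈ T, 0 ≤ f (x i) := by
  obtain ⟨a, ha, h1, h0⟩ := zeroHull_iff_weights.1 h
  by_contra! hneg
  have hpos : ∃ i ∈ T, 0 < a i := by
    by_contra! hle
    have := Finset.sum_nonpos hle
    linarith
  obtain ⟨j, hj, haj⟩ := hpos
  have hlt : ∑ i ∈ T, a i * f (x i) < 0 :=
    Finset.sum_neg' (fun i hi => mul_nonpos_of_nonneg_of_nonpos (ha i hi) (hneg i hi).le)
      ⟨j, hj, mul_neg_of_pos_of_neg haj (hneg j hj)⟩
  have := congrArg f h0
  simp only [map_sum, map_smul, smul_eq_mul, map_zero] at this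
  linarith

end ZeroHull

section Dual

open Module

variable {ι E : Type*} [NormedAddCommGroup E] [NormedSpace ℝ E]

/-- By separation, the origin lies in the hull of a finite family as soon as every closed half-space
with the origin on its boundary contains a member of the family. -/
theorem zeroHull_of_forall_exists_nonneg {x : ι → E} {T : Finset ι}
    (h : ∀ f : E →ₗ[ℝ] ℝ, ∃ i ∈ T, 0 ≤ f (x i)) : ZeroHull x T := by
  by_contra hn
  have hfin : (x '' (T : Set ι)).Finite := T.finite_toSet.image x
  obtain ⟨f, u, hf, hu⟩ := geometric_hahn_banach_closed_point (convex_convexHull ℝ _)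
    (hfin.isClosed_convexHull ℝ) hn
  obtain ⟨i, hi, hi0⟩ := h f
  have h1 := hf (x i) (subset_convexHull ℝ _ ⟨i, by exact_mod_cast hi, rfl⟩)
  rw [map_zero] at hu
  change 0 ≤ f (x i) at hi0
  linarith

end Dual

/-! ### Disjoint subfamilies with the origin in their hulls -/

section Splits

open Module

variable {ι E : Type*} [DecidableEq ι] [AddCommGroup E] [Module ℝ E]

/-- `Splits x I r`: the index set `I` contains `r` pairwise disjoint subsets, each indexing a
subfamily of `x` whose convex hull contains the origin. -/
def Splits (x : ι → E) : Finset ι → ℕ → Prop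
  | _, 0 => True
  | I, r + 1 => ∃ T ⊆ I, ZeroHull x T ∧ Splits x (I \ T) r

theorem Splits.mono {x : ι → E} {r : ℕ} : ∀ {I J : Finset ι}, I ⊆ J → Splits x I r →
    Splits x J r := by
  induction r with
  | zero => intros; trivial
  | succ r ih =>
    rintro I J hIJ ⟨T, hT, h0, hs⟩
    exact ⟨T, hT.trans hIJ, h0, ih (Finset.sdiff_subset_sdiff hIJ subset_rfl) hs⟩

theorem Splits.exists_coloring {x : ι → E} {r : ℕ} : ∀ {I : Finset ι}, Splits x I r →
    ∃ c : ι → ℕ, ∀ j < r, ∃ T ⊆ I, (∀ i ∈ T, c i = j) ∧ ZeroHull x T := by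
  induction r with
  | zero => intro I _; exact ⟨fun _ => 0, by simp⟩
  | succ r ih =>
    rintro I ⟨T, hT, h0, hs⟩
    obtain ⟨c, hc⟩ := ih hs
    refine ⟨fun i => if i ∈ T then r else c i, fun j hj => ?_⟩
    rcases Nat.lt_succ_iff_lt_or_eq.1 hj with hj | rfl
    · obtain ⟨T', hT', hcT', h0'⟩ := hc j hj
      refine ⟨T', hT'.trans Finset.sdiff_subset, fun i hi => ?_, h0'⟩
      have := (Finset.mem_sdiff.1 (hT' hi)).2
      simp [this, hcT' i hi]
    · exact ⟨T, hT, fun i hi => by simp [hi], h0⟩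

end Splits

/-! ### Greedy removal of simplices around a deep point -/

section Greedy

open Module

variable {ι E : Type*} [NormedAddCommGroup E] [NormedSpace ℝ E]

/-- `Deep x I D`: every closed half-space with the origin on its boundary contains at least `D`
members of the family `x` with index in `I`. The zero functional is included, which adds the
condition `D ≤ I.card`. -/
def Deep (x : ι → E) (I : Finset ι) (D : ℕ) : Prop :=
  ∀ f : E →ₗ[ℝ] ℝ, D ≤ (I.filter fun i => 0 ≤ f (x i)).card

theorem Deep.zeroHull {x : ι → E} {I : Finset ι} {D : ℕ} (h : Deep x I D) (hD : 0 < D) :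
    ZeroHull x I := by
  refine zeroHull_of_forall_exists_nonneg fun f => ?_
  obtain ⟨i, hi⟩ := Finset.card_pos.1 (hD.trans_le (h f))
  exact ⟨i, (Finset.mem_filter.1 hi).1, (Finset.mem_filter.1 hi).2⟩

variable [DecidableEq ι]

theorem card_filter_sdiff_ge (I T : Finset ι) (P : ι → Prop) [DecidablePred P] (D e : ℕ)
    (hI : D ≤ (I.filter P).card) (hT : (T.filter P).card ≤ e) :
    D - e ≤ ((I \ T).filter P).card := by
  have hsub : I.filter P ⊆ (I \ T).filter P ∪ T.filter P := by
    intro i hi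
    simp only [Finset.mem_union, Finset.mem_filter, Finset.mem_sdiff] at hi ⊢
    tauto
  have := (Finset.card_le_card hsub).trans (Finset.card_union_le _ _)
  omega

/-- A minimal simplex around a deep point can be removed at the cost of `d` in the depth: a closed
half-space containing all its vertices has them all on its boundary, so for a full-dimensional
simplex this happens only for the trivial half-space. -/
theorem Deep.exists_sdiff {x : ι → E} {I : Finset ι} {D d : ℕ} (hD : 0 < D) (hd : 0 < d)
    (hspan : finrank ℝ (Submodule.span ℝ (x '' (I : Set ι))) ≤ d) (h : Deep x I D) :
    ∃ T ⊆ I, T.card ≤ d + 1 ∧ ZeroHull x T ∧ Deep x (I \ T) (D - d) := by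
  obtain ⟨T, hTI, a, ha, h1, h0, hcard⟩ := (h.zeroHull hD).exists_pos_weights
  set W := Submodule.span ℝ (x '' (I : Set ι)) with hW
  set V := Submodule.span ℝ (x '' (T : Set ι)) with hV
  have : FiniteDimensional ℝ W := FiniteDimensional.span_of_finite ℝ (I.finite_toSet.image x)
  have hVW : V ≤ W := Submodule.span_mono (Set.image_mono (by exact_mod_cast hTI))
  have hVd : finrank ℝ V ≤ finrank ℝ W := Submodule.finrank_mono hVW
  -- A half-space missing a vertex of the simplex loses at most `d` points.
  have key : ∀ f : E →ₗ[ℝ] ℝ, (∃ t ∈ T, f (x t) < 0) →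
      D - d ≤ ((I \ T).filter fun i => 0 ≤ f (x i)).card := by
    rintro f ⟨t, ht, hft⟩
    refine card_filter_sdiff_ge I T _ D d (h f) ?_
    have hsub : (T.filter fun i => 0 ≤ f (x i)) ⊆ T.erase t := by
      intro i hi
      rw [Finset.mem_filter] at hi
      refine Finset.mem_erase.2 ⟨?_, hi.1⟩
      rintro rfl
      linarith [hi.2]
    have := Finset.card_le_card hsub
    rw [Finset.card_erase_of_mem ht] at this
    omega
  refine ⟨T, hTI, by omega, mem_convexHull_image_of_weights (fun i hi => (ha i hi).le) h1 h0,
    fun f => ?_⟩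
  by_cases hf : ∃ t ∈ T, f (x t) < 0
  · exact key f hf
  push Not at hf
  by_cases hT : T.card ≤ d
  · exact card_filter_sdiff_ge I T _ D d (h f) ((Finset.card_filter_le _ _).trans hT)
  have hVeq : V = W := Submodule.eq_of_le_of_finrank_le hVW (by omega)
  have hfT : ∀ t ∈ T, f (x t) = 0 := by
    have hs : ∑ i ∈ T, a i * f (x i) = 0 := by
      have := congrArg f h0
      simpa only [map_sum, map_smul, smul_eq_mul, map_zero] using this
    intro t ht
    have := (Finset.sum_eq_zero_iff_of_nonneg
      fun i hi => mul_nonneg (ha i hi).le (hf i hi)).1 hs t ht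
    exact (mul_eq_zero.1 this).resolve_left (ha t ht).ne'
  have hfI : ∀ i ∈ I, f (x i) = 0 := by
    have hle : V ≤ LinearMap.ker f := by
      rw [hV, Submodule.span_le]
      rintro _ ⟨t, ht, rfl⟩
      exact hfT t (by exact_mod_cast ht)
    intro i hi
    exact hle (hVeq ▸ Submodule.subset_span ⟨i, by exact_mod_cast hi, rfl⟩)
  -- The span is nonzero, so some functional is negative at a vertex.
  obtain ⟨t, ht, hxt⟩ : ∃ t ∈ T, x t ≠ 0 := by
    by_contra! hall
    have hbot : V = ⊥ := by
      rw [hV, Submodule.span_eq_bot]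
      rintro _ ⟨t, ht, rfl⟩
      exact hall t (by exact_mod_cast ht)
    have : finrank ℝ V = 0 := by rw [hbot]; simp
    omega
  obtain ⟨g, hg⟩ : ∃ g : E →ₗ[ℝ] ℝ, g (x t) < 0 := by
    by_contra! hall
    refine hxt ((Module.forall_dual_apply_eq_zero_iff ℝ (x t)).1 fun g => ?_)
    have h2 := hall (-g)
    rw [LinearMap.neg_apply] at h2
    exact le_antisymm (by linarith) (hall g)
  refine (key g ⟨t, ht, hg⟩).trans (Finset.card_le_card ?_)
  intro i hi
  rw [Finset.mem_filter] at hi ⊢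
  exact ⟨hi.1, (hfI i (Finset.mem_sdiff.1 hi.1).1).ge⟩

/-- `s` simplices with at most `d + 1` vertices each can be removed one after the other from a
family around a point of depth greater than `d * s`; what is left then still has depth `D` and at
least `n` members, so that `hbase` provides `r` further parts. -/
theorem Deep.splits_add {x : ι → E} {d : ℕ} (hd : 0 < d) {r n D : ℕ} (hDn : 0 < D)
    (hbase : ∀ J : Finset ι, finrank ℝ (Submodule.span ℝ (x '' (J : Set ι))) ≤ d → Deep x J D →
      n ≤ J.card → Splits x J r) (s : ℕ) :
    ∀ I : Finset ι, finrank ℝ (Submodule.span ℝ (x '' (I : Set ι))) ≤ d →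
      Deep x I (d * s + D) → n + (d + 1) * s ≤ I.card → Splits x I (r + s) := by
  induction s with
  | zero => intro I hspan h hn; exact hbase I hspan (by simpa using h) (by simpa using hn)
  | succ s ih =>
    intro I hspan h hn
    obtain ⟨T, hTI, hT, h0, hdeep⟩ := h.exists_sdiff (by omega) hd hspan
    have : FiniteDimensional ℝ (Submodule.span ℝ (x '' (I : Set ι))) :=
      FiniteDimensional.span_of_finite ℝ (I.finite_toSet.image x)
    have hmono : Submodule.span ℝ (x '' ((I \ T : Finset ι) : Set ι)) ≤
        Submodule.span ℝ (x '' (I : Set ι)) :=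
      Submodule.span_mono (Set.image_mono (by exact_mod_cast Finset.sdiff_subset))
    refine ⟨T, hTI, h0, ih _ ((Submodule.finrank_mono hmono).trans hspan) ?_ ?_⟩
    · have : d * (s + 1) + D - d = d * s + D := by rw [Nat.mul_succ]; omega
      rwa [this] at hdeep
    · rw [Finset.card_sdiff_of_subset hTI]
      rw [Nat.mul_succ] at hn
      omega

/-- A point of depth at least `d * s + 1`, where `d` bounds the dimension, lies in the hulls of
`s + 1` disjoint subfamilies. -/
theorem Deep.splits {x : ι → E} {I : Finset ι} {d s : ℕ} (hd : 0 < d)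
    (hspan : finrank ℝ (Submodule.span ℝ (x '' (I : Set ι))) ≤ d) (h : Deep x I (d * s + 1)) :
    Splits x I (s + 1) := by
  induction s generalizing I with
  | zero => exact ⟨I, subset_rfl, h.zeroHull (by omega), trivial⟩
  | succ s ih =>
    obtain ⟨T, hTI, -, h0, hdeep⟩ := h.exists_sdiff (by omega) hd hspan
    have : FiniteDimensional ℝ (Submodule.span ℝ (x '' (I : Set ι))) :=
      FiniteDimensional.span_of_finite ℝ (I.finite_toSet.image x)
    have hmono : Submodule.span ℝ (x '' ((I \ T : Finset ι) : Set ι)) ≤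
        Submodule.span ℝ (x '' (I : Set ι)) :=
      Submodule.span_mono (Set.image_mono (by exact_mod_cast Finset.sdiff_subset))
    refine ⟨T, hTI, h0, ih ((Submodule.finrank_mono hmono).trans hspan) ?_⟩
    have : d * (s + 1) + 1 - d = d * s + 1 := by rw [Nat.mul_succ]; omega
    rwa [this] at hdeep

end Greedy

/-! ### Decomposing a threefold cover by half-planes into two covers -/

section Covers

open Module

variable {ι E : Type*} [DecidableEq ι] [AddCommGroup E] [Module ℝ E]

/-- `Covers w x S`: every closed half-space with the origin on its boundary and `w` in its interior
contains a member of the family `x` with index in `S`. In the chart `{f | f w = 1}` of the dual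
space, this says that the closed half-spaces `{f | 0 ≤ f (x i)}`, for `i ∈ S`, cover the chart. -/
def Covers (w : E) (x : ι → E) (S : Finset ι) : Prop :=
  ∀ f : E →ₗ[ℝ] ℝ, 0 < f w → ∃ i ∈ S, 0 ≤ f (x i)

theorem Fin.sum_three_of_ne {i j k : Fin 3} (hij : i ≠ j) (hik : i ≠ k) (hjk : j ≠ k)
    (g : Fin 3 → ℝ) : ∑ l, g l = g i + g j + g k := by
  have : (Finset.univ : Finset (Fin 3)) = {i, j, k} := by
    revert i j k; decide
  rw [this, Finset.sum_insert (by simp [hij, hik]), Finset.sum_pair hjk]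
  ring

theorem Fin.eq_of_three {i j k : Fin 3} (hij : i ≠ j) (hik : i ≠ k) (hjk : j ≠ k) (l : Fin 3) :
    l = i ∨ l = j ∨ l = k := by
  revert i j k l; decide

/-- The contradiction at the heart of the decomposition. Suppose that no cover has a complementary
cover, and let `a 0, a 1, a 2` be a cover, written in the basis `e` in which `w` has coordinates
`(1, 1, 1)`. Every other member with a nonnegative coordinate has exactly one negative coordinate,
and can be exchanged for some `a i`; the resulting cover then forbids members whose negative
coordinate is the `i`-th. Counting the members over the three vertices of the triangle cut out by
`a 0, a 1, a 2` gives at least four members that can all be exchanged for the same `a i`, and these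
must all belong to each cover that avoids the other two, although three members suffice to cover. -/
theorem false_of_no_complementary_cover {w : E} {x : ι → E} {I : Finset ι}
    (hdeep : ∀ f : E →ₗ[ℝ] ℝ, 0 < f w → 3 ≤ (I.filter fun i => 0 ≤ f (x i)).card)
    (hcut : ∀ S ⊆ I, Covers w x S → ∃ q : E →ₗ[ℝ] ℝ, 0 < q w ∧ ∀ i ∈ I \ S, q (x i) < 0)
    (hsmall : ∀ S ⊆ I, Covers w x S → ∃ G ⊆ S, G.card ≤ 3 ∧ Covers w x G)
    (a : Fin 3 → ι) (ha : Function.Injective a) (haI : ∀ k, a k ∈ I)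
    (e : Basis (Fin 3) ℝ E) (hw : w = ∑ k, e k)
    (hae : ∀ (f : E →ₗ[ℝ] ℝ) k, 0 ≤ f (x (a k)) ↔ 0 ≤ f (e k)) : False := by
  set S : Finset ι := Finset.univ.image a with hS
  have hSI : S ⊆ I := by
    intro i hi
    obtain ⟨k, -, rfl⟩ := Finset.mem_image.1 hi
    exact haI k
  have hScard : S.card = 3 := by rw [hS, Finset.card_image_of_injective _ ha]; simp
  have haS : ∀ k, a k ∈ S := fun k => Finset.mem_image_of_mem a (Finset.mem_univ k)
  set c : ι → Fin 3 → ℝ := fun d k => e.repr (x d) k with hc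
  have hfx : ∀ (f : E →ₗ[ℝ] ℝ) d, f (x d) = ∑ k, c d k * f (e k) := by
    intro f d
    conv_lhs => rw [← e.sum_repr (x d), map_sum]
    simp only [map_smul, smul_eq_mul, hc]
  have hfw : ∀ f : E →ₗ[ℝ] ℝ, f w = ∑ k, f (e k) := by
    intro f; rw [hw, map_sum]
  -- A cover with three members has a witness that is covered by exactly these members.
  have hcut3 : ∀ T ⊆ I, T.card ≤ 3 → Covers w x T → ∃ q : E →ₗ[ℝ] ℝ, 0 < q w ∧
      (∀ i ∈ I \ T, q (x i) < 0) ∧ ∀ i ∈ T, 0 ≤ q (x i) := by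
    intro T hT hT3 hcov
    obtain ⟨q, hq, hqn⟩ := hcut T hT hcov
    refine ⟨q, hq, hqn, ?_⟩
    have hsub : (I.filter fun i => 0 ≤ q (x i)) ⊆ T := by
      intro i hi
      rw [Finset.mem_filter] at hi
      by_contra hiT
      linarith [hqn i (Finset.mem_sdiff.2 ⟨hi.1, hiT⟩), hi.2]
    have heq := Finset.eq_of_subset_of_card_le hsub (hT3.trans (hdeep q hq))
    intro i hi
    rw [← heq] at hi
    exact (Finset.mem_filter.1 hi).2
  have hSc : Covers w x S := by
    intro f hf
    rw [hfw] at hf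
    obtain ⟨k, -, hk⟩ := Finset.exists_lt_of_sum_lt (s := Finset.univ) (f := fun _ : Fin 3 => (0:ℝ))
      (g := fun k => f (e k)) (by simpa using hf)
    exact ⟨a k, haS k, (hae f k).2 hk.le⟩
  -- Exchanging `a i` for `d`.
  set swap : Fin 3 → ι → Finset ι := fun i d => insert d ((Finset.univ.erase i).image a) with hswap
  have hswapI : ∀ i, ∀ d ∈ I \ S, swap i d ⊆ I := by
    intro i d hd t ht
    rcases Finset.mem_insert.1 ht with rfl | ht
    · exact (Finset.mem_sdiff.1 hd).1
    · obtain ⟨k, -, rfl⟩ := Finset.mem_image.1 ht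
      exact haI k
  have hswap3 : ∀ i d, (swap i d).card ≤ 3 := by
    intro i d
    refine (Finset.card_insert_le _ _).trans ?_
    have := Finset.card_image_le (s := Finset.univ.erase i) (f := a)
    simp at this
    omega
  have hswapcut : ∀ i, ∀ d ∈ I \ S, Covers w x (swap i d) → ∃ q : E →ₗ[ℝ] ℝ, 0 < q w ∧
      (∀ j, j ≠ i → 0 ≤ q (e j)) ∧ q (e i) < 0 ∧ 0 ≤ q (x d) ∧
      ∀ d' ∈ I \ S, d' ≠ d → q (x d') < 0 := by
    intro i d hd hcov
    obtain ⟨q, hq, hqn, hqp⟩ := hcut3 _ (hswapI i d hd) (hswap3 i d) hcov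
    have hdS := (Finset.mem_sdiff.1 hd).2
    refine ⟨q, hq, fun j hj => (hae q j).1 (hqp _ ?_), ?_, hqp d (Finset.mem_insert_self _ _), ?_⟩
    · exact Finset.mem_insert_of_mem (Finset.mem_image_of_mem a (by simpa using hj))
    · have hai : a i ∈ I \ swap i d := by
        refine Finset.mem_sdiff.2 ⟨haI i, fun h => ?_⟩
        rcases Finset.mem_insert.1 h with h | h
        · exact hdS (h ▸ haS i)
        · obtain ⟨k, hk, hki⟩ := Finset.mem_image.1 h
          exact (Finset.mem_erase.1 hk).1 (ha hki)
      have := hqn _ hai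
      by_contra hge
      linarith [(hae q i).2 (not_lt.1 hge)]
    · intro d' hd' hne
      refine hqn d' (Finset.mem_sdiff.2 ⟨(Finset.mem_sdiff.1 hd').1, fun h => ?_⟩)
      rcases Finset.mem_insert.1 h with h | h
      · exact hne h
      · obtain ⟨k, -, rfl⟩ := Finset.mem_image.1 h
        exact (Finset.mem_sdiff.1 hd').2 (haS k)
  have hswapcov : ∀ {i j k : Fin 3}, i ≠ j → i ≠ k → j ≠ k → ∀ d,
      (∀ f : E →ₗ[ℝ] ℝ, 0 < f (e i) + f (e j) + f (e k) → f (e j) < 0 → f (e k) < 0 →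
        0 ≤ f (x d)) → Covers w x (swap i d) := by
    intro i j k hij hik hjk d h f hf
    rw [hfw, Fin.sum_three_of_ne hij hik hjk] at hf
    have hmem : ∀ l, l ≠ i → a l ∈ swap i d := fun l hl =>
      Finset.mem_insert_of_mem (Finset.mem_image_of_mem a (by simpa using hl))
    by_cases hj : 0 ≤ f (e j)
    · exact ⟨a j, hmem j hij.symm, (hae f j).2 hj⟩
    by_cases hk : 0 ≤ f (e k)
    · exact ⟨a k, hmem k hik.symm, (hae f k).2 hk⟩
    · exact ⟨d, Finset.mem_insert_self _ _, h f hf (not_le.1 hj) (not_le.1 hk)⟩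
  -- The members outside `S` whose only negative coordinate is the `k`-th.
  set N : Fin 3 → Finset ι := fun k =>
    (I \ S).filter fun d => c d k < 0 ∧ ∀ j, j ≠ k → 0 ≤ c d j with hN
  have hNmem : ∀ k d, d ∈ N k ↔ d ∈ I \ S ∧ c d k < 0 ∧ ∀ j, j ≠ k → 0 ≤ c d j := by
    intro k d; simp [hN]
  have hNdisj : ∀ j k, j ≠ k → Disjoint (N j) (N k) := by
    intro j k hjk
    rw [Finset.disjoint_left]
    intro d hd hd'
    have h1 := ((hNmem j d).1 hd).2.1
    have h2 := ((hNmem k d).1 hd').2.2 j hjk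
    linarith
  obtain ⟨q₀, hq₀, hq₀n, hq₀p⟩ := hcut3 S hSI hScard.le hSc
  -- A member with a nonnegative `k`-th coordinate has exactly one negative coordinate.
  have hvertex : ∀ {i j k : Fin 3}, i ≠ j → i ≠ k → j ≠ k → ∀ d ∈ I \ S, 0 ≤ c d k →
      d ∈ N i ∪ N j := by
    intro i j k hij hik hjk d hd hk
    have hall : ∀ l, 0 ≤ q₀ (e l) := fun l => (hae q₀ l).1 (hq₀p _ (haS l))
    by_cases hi : 0 ≤ c d i
    · by_cases hj : 0 ≤ c d j
      · exfalso
        have h1 := hq₀n d hd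
        rw [hfx, Fin.sum_three_of_ne hij hik hjk] at h1
        have := mul_nonneg hi (hall i)
        have := mul_nonneg hj (hall j)
        have := mul_nonneg hk (hall k)
        linarith
      · refine Finset.mem_union_right _ ((hNmem j d).2 ⟨hd, not_le.1 hj, fun l hl => ?_⟩)
        rcases Fin.eq_of_three hij hik hjk l with rfl | rfl | rfl
        · exact hi
        · exact absurd rfl hl
        · exact hk
    · by_cases hj : 0 ≤ c d j
      · refine Finset.mem_union_left _ ((hNmem i d).2 ⟨hd, not_le.1 hi, fun l hl => ?_⟩)
        rcases Fin.eq_of_three hij hik hjk l with rfl | rfl | rfl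
        · exact absurd rfl hl
        · exact hj
        · exact hk
      · exfalso
        rw [not_le] at hi hj
        -- If only the `k`-th coordinate is nonnegative, then `d` can be exchanged for `a k`, but
        -- the witness of the new cover is negative at `a k` and nonnegative at the other two, and
        -- hence negative at `d`.
        have hcov : Covers w x (swap k d) := by
          refine hswapcov hik.symm hjk.symm hij d fun f hs hfi hfj => ?_
          rw [hfx, Fin.sum_three_of_ne hij hik hjk]
          have := mul_nonneg_of_nonpos_of_nonpos hi.le hfi.le
          have := mul_nonneg_of_nonpos_of_nonpos hj.le hfj.le
          have := mul_nonneg hk (show 0 ≤ f (e k) by linarith)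
          linarith
        obtain ⟨q, hq, hqp, hqk, hqd, -⟩ := hswapcut k d hd hcov
        rw [hfw, Fin.sum_three_of_ne hij hik hjk] at hq
        rw [hfx, Fin.sum_three_of_ne hij hik hjk] at hqd
        have h1 := mul_nonpos_of_nonneg_of_nonpos hk hqk.le
        have h2 := mul_nonpos_of_nonpos_of_nonneg hi.le (hqp i hik)
        have h3 := mul_nonpos_of_nonpos_of_nonneg hj.le (hqp j hjk)
        have h2' : c d i * q (e i) = 0 := by linarith
        have h3' : c d j * q (e j) = 0 := by linarith
        have := (mul_eq_zero.1 h2').resolve_left hi.ne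
        have := (mul_eq_zero.1 h3').resolve_left hj.ne
        linarith
  -- Just beyond the vertex where `a i` and `a j` meet, only `a k` among `a 0, a 1, a 2` covers.
  have htwo : ∀ {i j k : Fin 3}, i ≠ j → i ≠ k → j ≠ k → 2 ≤ (N i).card + (N j).card := by
    intro i j k hij hik hjk
    have hev : ∀ᶠ ε : ℝ in nhdsWithin 0 (Set.Ioi 0), ∀ d ∈ I, c d k < 0 →
        c d k + ε * (2 * c d k - c d i - c d j) < 0 := by
      rw [Filter.eventually_all_finset]
      intro d _
      by_cases hd : c d k < 0
      · have hcont : Filter.Tendsto (fun ε : ℝ => c d k + ε * (2 * c d k - c d i - c d j))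
            (nhdsWithin 0 (Set.Ioi 0)) (nhds (c d k + 0 * (2 * c d k - c d i - c d j))) :=
          ((by fun_prop : Continuous fun ε : ℝ =>
            c d k + ε * (2 * c d k - c d i - c d j)).tendsto 0).mono_left nhdsWithin_le_nhds
        filter_upwards [hcont.eventually (gt_mem_nhds (by simpa using hd))] with ε hε _
        exact hε
      · exact Filter.Eventually.of_forall fun ε h => absurd h hd
    obtain ⟨ε, hεd, hε⟩ := (hev.and self_mem_nhdsWithin).exists
    replace hε : 0 < ε := hε
    set f : E →ₗ[ℝ] ℝ := e.constr ℝ (fun l => if l = k then 1 + 2 * ε else -ε) with hf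
    have hfk : f (e k) = 1 + 2 * ε := by rw [hf, e.constr_basis]; simp
    have hfi : f (e i) = -ε := by rw [hf, e.constr_basis]; simp [hik]
    have hfj : f (e j) = -ε := by rw [hf, e.constr_basis]; simp [hjk]
    have hsum := hdeep f (by rw [hfw, Fin.sum_three_of_ne hij hik hjk, hfk, hfi, hfj]; linarith)
    have hsub : (I.filter fun t => 0 ≤ f (x t)) ⊆ insert (a k) (N i ∪ N j) := by
      intro t ht
      obtain ⟨htI, ht0⟩ := Finset.mem_filter.1 ht
      by_cases htS : t ∈ S
      · obtain ⟨l, -, rfl⟩ := Finset.mem_image.1 htS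
        rw [hae] at ht0
        rcases Fin.eq_of_three hij hik hjk l with rfl | rfl | rfl
        · linarith
        · linarith
        · exact Finset.mem_insert_self _ _
      · refine Finset.mem_insert_of_mem
          (hvertex hij hik hjk t (Finset.mem_sdiff.2 ⟨htI, htS⟩) ?_)
        by_contra hneg
        have h1 := hεd t htI (not_le.1 hneg)
        rw [hfx, Fin.sum_three_of_ne hij hik hjk, hfk, hfi, hfj] at ht0
        linarith
    have h1 := Finset.card_le_card hsub
    have h2 := Finset.card_insert_le (a k) (N i ∪ N j)
    have h3 := Finset.card_union_le (N i) (N j)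
    omega
  -- Members of type `k` can be exchanged for the one of `a i`, `a j` with the larger coordinate.
  have hexch : ∀ {i j k : Fin 3}, i ≠ j → i ≠ k → j ≠ k → ∀ d ∈ N k, c d j ≤ c d i →
      Covers w x (swap i d) := by
    intro i j k hij hik hjk d hd hle
    obtain ⟨hdI, hdk, hdp⟩ := (hNmem k d).1 hd
    refine hswapcov hij hik hjk d fun f hs hfj hfk => ?_
    rw [hfx, Fin.sum_three_of_ne hij hik hjk]
    have h1 := mul_nonneg_of_nonpos_of_nonpos hdk.le hfk.le
    have h2 := mul_nonneg (sub_nonneg.2 hle) (neg_nonneg.2 hfj.le)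
    have h3 := mul_nonneg (hdp i hik) (show 0 ≤ f (e i) + f (e j) by linarith)
    nlinarith
  -- The witness of the exchanged cover is nonnegative at every member of type `i`, but must be
  -- negative at every member outside `S` other than `d`.
  have hempty : ∀ {i k : Fin 3}, i ≠ k → ∀ d ∈ N k, Covers w x (swap i d) → N i = ∅ := by
    intro i k hik d hd hcov
    obtain ⟨q, hq, hqp, hqi, -, hqn⟩ := hswapcut i d ((hNmem k d).1 hd).1 hcov
    refine Finset.eq_empty_of_forall_notMem fun d' hd' => ?_
    obtain ⟨hd'I, hd'i, hd'p⟩ := (hNmem i d').1 hd'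
    have hne : d' ≠ d := by
      rintro rfl
      exact Finset.disjoint_left.1 (hNdisj i k hik) hd' hd
    have hneg := hqn d' hd'I hne
    rw [hfx] at hneg
    have : 0 ≤ ∑ l, c d' l * q (e l) := by
      refine Finset.sum_nonneg fun l _ => ?_
      by_cases hl : l = i
      · rw [hl]
        exact mul_nonneg_of_nonpos_of_nonpos hd'i.le hqi.le
      · exact mul_nonneg (hd'p l hl) (hqp l hl)
    linarith
  -- Without members of type `i`, at least two are of type `j` and two of type `k`, and all of them
  -- can be exchanged for `a i`: exchanging for another `a l` would leave no member of type `l`.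
  have hfinal : ∀ {i j k : Fin 3}, i ≠ j → i ≠ k → j ≠ k → N i = ∅ → False := by
    intro i j k hij hik hjk hi
    have hNk : 2 ≤ (N k).card := by
      have := htwo hik hij hjk.symm
      simpa [hi] using this
    have hNj : 2 ≤ (N j).card := by
      have := htwo hij hik hjk
      simpa [hi] using this
    have hcov : ∀ d ∈ N j ∪ N k, Covers w x (swap i d) := by
      intro d hd
      rcases Finset.mem_union.1 hd with hd | hd
      · by_cases hle : c d k ≤ c d i
        · exact hexch hik hij hjk.symm d hd hle
        · have := hempty hjk.symm d hd (hexch hik.symm hjk.symm hij d hd (not_le.1 hle).le)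
          simp [this] at hNk
      · by_cases hle : c d j ≤ c d i
        · exact hexch hij hik hjk d hd hle
        · have := hempty hjk d hd (hexch hij.symm hjk hik d hd (not_le.1 hle).le)
          simp [this] at hNj
    -- A cover `G` with at most three members that avoids `a j` and `a k` has a witness `q`. It is
    -- negative at `a j` and `a k`, so it is nonnegative at each exchangeable `d`, which must then
    -- belong to `G`.
    have hrest : Covers w x (I \ {a j, a k}) := by
      intro f hf
      have h1 := card_filter_sdiff_ge I {a j, a k} (fun i => 0 ≤ f (x i)) 3 2 (hdeep f hf)
        ((Finset.card_filter_le _ _).trans Finset.card_le_two)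
      obtain ⟨t, ht⟩ := Finset.card_pos.1 (lt_of_lt_of_le (by norm_num) h1)
      exact ⟨t, (Finset.mem_filter.1 ht).1, (Finset.mem_filter.1 ht).2⟩
    obtain ⟨G, hG, hG3, hGcov⟩ := hsmall _ Finset.sdiff_subset hrest
    obtain ⟨q, hq, hqn⟩ := hcut G (hG.trans Finset.sdiff_subset) hGcov
    have hsub : N j ∪ N k ⊆ G := by
      intro d hd
      obtain ⟨t, ht, ht0⟩ := hcov d hd q hq
      have hdI : d ∈ I \ S := by
        rcases Finset.mem_union.1 hd with hd | hd
        · exact ((hNmem j d).1 hd).1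
        · exact ((hNmem k d).1 hd).1
      have htG : t ∈ G := by
        by_contra htG
        linarith [hqn t (Finset.mem_sdiff.2 ⟨hswapI i d hdI ht, htG⟩)]
      rcases Finset.mem_insert.1 ht with rfl | ht
      · exact htG
      · exfalso
        obtain ⟨l, hl, rfl⟩ := Finset.mem_image.1 ht
        have hn := (Finset.mem_sdiff.1 (hG htG)).2
        rcases Fin.eq_of_three hij hik hjk l with rfl | rfl | rfl
        · exact (Finset.mem_erase.1 hl).1 rfl
        · simp at hn
        · simp at hn
    have h1 := Finset.card_le_card hsub
    rw [Finset.card_union_of_disjoint (hNdisj j k hjk)] at h1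
    omega
  have h01 : (0 : Fin 3) ≠ 1 := by decide
  have h02 : (0 : Fin 3) ≠ 2 := by decide
  have h12 : (1 : Fin 3) ≠ 2 := by decide
  have hmain : ∀ {i j k : Fin 3}, i ≠ j → i ≠ k → j ≠ k → (N k).Nonempty → False := by
    intro i j k hij hik hjk hk
    obtain ⟨d, hd⟩ := hk
    rcases le_total (c d j) (c d i) with hle | hle
    · exact hfinal hij hik hjk (hempty hik d hd (hexch hij hik hjk d hd hle))
    · exact hfinal hij.symm hjk hik (hempty hjk d hd (hexch hij.symm hjk hik d hd hle))
  by_cases h : (N 0).Nonempty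
  · exact hmain h12 h01.symm h02.symm h
  · have h1 := htwo h01 h02 h12
    rw [Finset.not_nonempty_iff_eq_empty.1 h] at h1
    refine hmain h02 h01 h12.symm (Finset.card_pos.1 ?_)
    simp at h1
    omega

end Covers

section Decomposition

open Module

variable {ι E : Type*} [DecidableEq ι] [AddCommGroup E] [Module ℝ E]

omit [DecidableEq ι] in
/-- Helly's theorem in the plane `{f | f w = 1}` of the dual space. -/
theorem Covers.exists_card_le_three [FiniteDimensional ℝ E] (hE : finrank ℝ E = 3) {w : E}
    (hw : w ≠ 0) {x : ι → E} {I : Finset ι} (h : Covers w x I) :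
    ∃ G ⊆ I, G.card ≤ 3 ∧ Covers w x G := by
  by_contra! hno
  obtain ⟨g, hg⟩ : ∃ g : E →ₗ[ℝ] ℝ, g w ≠ 0 := by
    by_contra! hall
    exact hw ((forall_dual_apply_eq_zero_iff ℝ w).1 hall)
  set f₀ : Dual ℝ E := (g w)⁻¹ • g with hf₀
  have hf₀w : f₀ w = 1 := by simp [hf₀, hg]
  set K : Submodule ℝ (Dual ℝ E) := LinearMap.ker (Dual.eval ℝ E w) with hK
  have hKfin : finrank ℝ K = 2 := by
    have hsurj : LinearMap.range (Dual.eval ℝ E w) = ⊤ := by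
      rw [LinearMap.range_eq_top]
      intro t
      exact ⟨t • f₀, by simp [hf₀w]⟩
    have := LinearMap.finrank_range_add_finrank_ker (Dual.eval ℝ E w)
    rw [hsurj, finrank_top, finrank_self, Subspace.dual_finrank_eq, hE, ← hK] at this
    exact Nat.add_left_cancel this
  have hconv : ∀ i ∈ I, Convex ℝ {u : K | u.1 (x i) < -f₀ (x i)} := fun i _ =>
    convex_halfSpace_lt ((Dual.eval ℝ E (x i)).comp K.subtype).isLinear _
  have hinter : ∀ G ⊆ I, G.card ≤ finrank ℝ K + 1 →
      (⋂ i ∈ G, {u : K | u.1 (x i) < -f₀ (x i)}).Nonempty := by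
    intro G hG hcard
    rw [hKfin] at hcard
    have hnot := hno G hG hcard
    unfold Covers at hnot
    push Not at hnot
    obtain ⟨f, hfw, hf⟩ := hnot
    have hmem : (f w)⁻¹ • f - f₀ ∈ K := by
      rw [hK, LinearMap.mem_ker, Dual.eval_apply]
      simp [hf₀w, hfw.ne']
    refine ⟨⟨_, hmem⟩, ?_⟩
    refine Set.mem_iInter₂.2 fun i hi => ?_
    have h1 := mul_neg_of_pos_of_neg (inv_pos.2 hfw) (hf i hi)
    change ((f w)⁻¹ • f - f₀) (x i) < -f₀ (x i)
    rw [LinearMap.sub_apply, LinearMap.smul_apply, smul_eq_mul]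
    linarith
  obtain ⟨u, hu⟩ := Convex.helly_theorem' (𝕜 := ℝ) (E := K) (s := I)
    (F := fun i => {u : K | u.1 (x i) < -f₀ (x i)}) hconv hinter
  have huw : u.1 w = 0 := LinearMap.mem_ker.1 u.2
  obtain ⟨i, hi, hi0⟩ := h (f₀ + u.1) (by rw [LinearMap.add_apply, hf₀w, huw]; norm_num)
  have h1 : u.1 (x i) < -f₀ (x i) := Set.mem_iInter₂.1 hu i hi
  rw [LinearMap.add_apply] at hi0
  linarith

/-- If every closed half-space with the origin on its boundary and `w` in its interior contains at
least three members of the family, then the family splits into two covers. -/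
theorem exists_complementary_covers [FiniteDimensional ℝ E] (hE : finrank ℝ E = 3) {w : E}
    (hw : w ≠ 0) {x : ι → E} {I : Finset ι}
    (hdeep : ∀ f : E →ₗ[ℝ] ℝ, 0 < f w → 3 ≤ (I.filter fun i => 0 ≤ f (x i)).card) :
    ∃ S ⊆ I, Covers w x S ∧ Covers w x (I \ S) := by
  by_contra! hno
  have hcut : ∀ S ⊆ I, Covers w x S → ∃ q : E →ₗ[ℝ] ℝ, 0 < q w ∧ ∀ i ∈ I \ S, q (x i) < 0 := by
    intro S hS hcov
    have := hno S hS hcov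
    unfold Covers at this
    push Not at this
    exact this
  have hsmall : ∀ S ⊆ I, Covers w x S → ∃ G ⊆ S, G.card ≤ 3 ∧ Covers w x G :=
    fun S _ h => h.exists_card_le_three hE hw
  have hsubset : ∀ (S : Finset ι) (q : E →ₗ[ℝ] ℝ), (∀ i ∈ I \ S, q (x i) < 0) →
      (I.filter fun i => 0 ≤ q (x i)) ⊆ S := by
    intro S q hq i hi
    rw [Finset.mem_filter] at hi
    by_contra hiS
    linarith [hq i (Finset.mem_sdiff.2 ⟨hi.1, hiS⟩), hi.2]
  have hmin : ∀ S ⊆ I, Covers w x S → 3 ≤ S.card := by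
    intro S hS hcov
    obtain ⟨q, hq, hqn⟩ := hcut S hS hcov
    exact (hdeep q hq).trans (Finset.card_le_card (hsubset S q hqn))
  have hIc : Covers w x I := by
    intro f hf
    obtain ⟨i, hi⟩ := Finset.card_pos.1 (lt_of_lt_of_le (by norm_num) (hdeep f hf))
    exact ⟨i, (Finset.mem_filter.1 hi).1, (Finset.mem_filter.1 hi).2⟩
  obtain ⟨S, hSI, hS3, hSc⟩ := hsmall I subset_rfl hIc
  have hScard : S.card = 3 := le_antisymm hS3 (hmin S hSI hSc)
  obtain ⟨q, hq, hqn⟩ := hcut S hSI hSc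
  have hnonzero : ∀ i ∈ S, x i ≠ 0 := by
    intro i hi h0
    have := hmin {i} (by simpa using hSI hi) fun f _ => ⟨i, by simp, by simp [h0]⟩
    simp at this
  -- The witness `q` can be perturbed, so it is positive on the members of `S`.
  have hqpos : ∀ i ∈ S, 0 < q (x i) := by
    intro i hi
    obtain ⟨g, hg⟩ : ∃ g : E →ₗ[ℝ] ℝ, g (x i) < 0 := by
      by_contra! hall
      refine hnonzero i hi ((forall_dual_apply_eq_zero_iff ℝ (x i)).1 fun g => ?_)
      have h2 := hall (-g)
      rw [LinearMap.neg_apply] at h2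
      exact le_antisymm (by linarith) (hall g)
    have hlim : ∀ y : E, Filter.Tendsto (fun ε : ℝ => q y + ε * g y) (nhdsWithin 0 (Set.Ioi 0))
        (nhds (q y)) := by
      intro y
      have : Filter.Tendsto (fun ε : ℝ => q y + ε * g y) (nhds 0) (nhds (q y + 0 * g y)) :=
        (by fun_prop : Continuous fun ε : ℝ => q y + ε * g y).tendsto 0
      rw [zero_mul, add_zero] at this
      exact this.mono_left nhdsWithin_le_nhds
    have hev : ∀ᶠ ε : ℝ in nhdsWithin 0 (Set.Ioi 0), ∀ d ∈ I \ S, q (x d) + ε * g (x d) < 0 := by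
      rw [Filter.eventually_all_finset]
      intro d hd
      exact (hlim (x d)).eventually (gt_mem_nhds (hqn d hd))
    obtain ⟨ε, ⟨hεd, hεw⟩, hε⟩ :=
      ((hev.and ((hlim w).eventually (lt_mem_nhds hq))).and self_mem_nhdsWithin).exists
    replace hε : 0 < ε := hε
    have hsub := hsubset S (q + ε • g) (by simpa using hεd)
    have heq := Finset.eq_of_subset_of_card_le hsub
      (hS3.trans (hdeep (q + ε • g) (by simpa using hεw)))
    have := (Finset.mem_filter.1 (heq ▸ hi)).2
    simp only [LinearMap.add_apply, LinearMap.smul_apply, smul_eq_mul] at this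
    have := mul_neg_of_pos_of_neg hε hg
    linarith
  set a : Fin 3 → ι := fun k => ((S.equivFinOfCardEq hScard).symm k : ι) with ha
  have hainj : Function.Injective a :=
    Subtype.val_injective.comp (S.equivFinOfCardEq hScard).symm.injective
  have haS : ∀ k, a k ∈ S := fun k => ((S.equivFinOfCardEq hScard).symm k).2
  have hcovS : ∀ f : E →ₗ[ℝ] ℝ, 0 < f w → ∃ k, 0 ≤ f (x (a k)) := by
    intro f hf
    obtain ⟨i, hi, h0⟩ := hSc f hf
    exact ⟨S.equivFinOfCardEq hScard ⟨i, hi⟩, by simpa [ha] using h0⟩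
  -- No member of `S` is redundant.
  have hirr : ∀ k, ∃ f : E →ₗ[ℝ] ℝ, 0 < f w ∧ ∀ j, j ≠ k → f (x (a j)) < 0 := by
    intro k
    by_contra! hk
    have h1 := hmin ((Finset.univ.erase k).image a) (fun i hi => by
      obtain ⟨j, -, rfl⟩ := Finset.mem_image.1 hi
      exact hSI (haS j)) (fun f hf => by
      obtain ⟨j, hj, h0⟩ := hk f hf
      exact ⟨a j, Finset.mem_image_of_mem a (by simpa using hj), h0⟩)
    have h2 := Finset.card_image_le (s := Finset.univ.erase k) (f := a)
    simp at h2
    omega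
  -- There is no linear relation between the members of `S` with exactly one positive coefficient:
  -- evaluated at the functional that only the `k`-th member covers, its terms are all nonnegative,
  -- so the other coefficients vanish.
  have hred : ∀ (g : Fin 3 → ℝ) k, ∑ j, g j • x (a j) = 0 → 0 < g k → (∀ j, j ≠ k → g j ≤ 0) →
      False := by
    intro g k hg hgk hgj
    obtain ⟨f, hfw, hf⟩ := hirr k
    obtain ⟨l, hl⟩ := hcovS f hfw
    have hlk : l = k := by
      by_contra hne
      linarith [hf l hne]
    subst hlk
    have hsum : ∀ f : E →ₗ[ℝ] ℝ, ∑ j, g j * f (x (a j)) = 0 := by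
      intro f
      have := congrArg f hg
      simpa only [map_sum, map_smul, smul_eq_mul, map_zero] using this
    have hterm : ∀ j ∈ Finset.univ, 0 ≤ g j * f (x (a j)) := by
      intro j _
      by_cases hj : j = l
      · rw [hj]; exact mul_nonneg hgk.le hl
      · exact mul_nonneg_of_nonpos_of_nonpos (hgj j hj) (hf j hj).le
    have hz := (Finset.sum_eq_zero_iff_of_nonneg hterm).1 (hsum f)
    have hgz : ∀ j, j ≠ l → g j = 0 := fun j hj =>
      (mul_eq_zero.1 (hz j (Finset.mem_univ j))).resolve_right (hf j hj).ne
    have hq0 := hsum q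
    rw [Finset.sum_eq_single l (fun j _ hj => by rw [hgz j hj, zero_mul]) (by simp)] at hq0
    exact (mul_pos hgk (hqpos _ (haS l))).ne' hq0
  -- A relation with coefficients of both signs has, up to sign, exactly one positive coefficient;
  -- one with coefficients of a single sign contradicts the positivity of `q`.
  have hind : LinearIndependent ℝ fun k => x (a k) := by
    rw [Fintype.linearIndependent_iff]
    intro g hg
    have hq0 : g 0 * q (x (a 0)) + g 1 * q (x (a 1)) + g 2 * q (x (a 2)) = 0 := by
      have := congrArg q hg
      simpa only [Fin.sum_univ_three, map_add, map_smul, smul_eq_mul, map_zero] using this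
    have hng : ∑ j, (-g) j • x (a j) = 0 := by
      simp only [Pi.neg_apply, neg_smul, Finset.sum_neg_distrib, hg, neg_zero]
    have p0 := hqpos _ (haS 0)
    have p1 := hqpos _ (haS 1)
    have p2 := hqpos _ (haS 2)
    rcases le_or_gt (g 0) 0 with h0 | h0 <;> rcases le_or_gt (g 1) 0 with h1 | h1 <;>
      rcases le_or_gt (g 2) 0 with h2 | h2
    · have m0 := mul_nonpos_of_nonpos_of_nonneg h0 p0.le
      have m1 := mul_nonpos_of_nonpos_of_nonneg h1 p1.le
      have m2 := mul_nonpos_of_nonpos_of_nonneg h2 p2.le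
      intro k
      fin_cases k
      · exact (mul_eq_zero.1 (show g 0 * q (x (a 0)) = 0 by linarith)).resolve_right p0.ne'
      · exact (mul_eq_zero.1 (show g 1 * q (x (a 1)) = 0 by linarith)).resolve_right p1.ne'
      · exact (mul_eq_zero.1 (show g 2 * q (x (a 2)) = 0 by linarith)).resolve_right p2.ne'
    · exact (hred g 2 hg h2 (by simp [Fin.forall_fin_succ, h0, h1])).elim
    · exact (hred g 1 hg h1 (by simp [Fin.forall_fin_succ, h0, h2])).elim
    · have : g 0 < 0 := by
        by_contra hge
        nlinarith [mul_nonneg (not_lt.1 hge) p0.le, mul_pos h1 p1, mul_pos h2 p2]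
      exact (hred (-g) 0 hng (by simpa) (by simp [Fin.forall_fin_succ, h1.le, h2.le])).elim
    · exact (hred g 0 hg h0 (by simp [Fin.forall_fin_succ, h1, h2])).elim
    · have : g 1 < 0 := by
        by_contra hge
        nlinarith [mul_nonneg (not_lt.1 hge) p1.le, mul_pos h0 p0, mul_pos h2 p2]
      exact (hred (-g) 1 hng (by simpa) (by simp [Fin.forall_fin_succ, h0.le, h2.le])).elim
    · have : g 2 < 0 := by
        by_contra hge
        nlinarith [mul_nonneg (not_lt.1 hge) p2.le, mul_pos h0 p0, mul_pos h1 p1]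
      exact (hred (-g) 2 hng (by simpa) (by simp [Fin.forall_fin_succ, h0.le, h1.le])).elim
    · nlinarith [mul_pos h0 p0, mul_pos h1 p1, mul_pos h2 p2]
  set b : Basis (Fin 3) ℝ E :=
    basisOfLinearIndependentOfCardEqFinrank hind (by rw [hE, Fintype.card_fin]) with hb
  have hbk : ∀ k, b k = x (a k) := fun k => by
    rw [hb, coe_basisOfLinearIndependentOfCardEqFinrank]
  have hwpos : ∀ k, 0 < b.repr w k := by
    intro k
    by_contra hle
    rw [not_lt] at hle
    obtain ⟨f, hfw, hf⟩ := hirr k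
    -- Lowering the value of `f` at the `k`-th member does not lower its value at `w`.
    set f' : E →ₗ[ℝ] ℝ := b.constr ℝ fun j => if j = k then min (f (b k)) (-1) else f (b j)
    have hf'b : ∀ j, f' (b j) = if j = k then min (f (b k)) (-1) else f (b j) := fun j =>
      b.constr_basis ℝ _ j
    have hexp : ∀ f : E →ₗ[ℝ] ℝ, f w = ∑ j, b.repr w j * f (b j) := by
      intro f
      conv_lhs => rw [← b.sum_repr w, map_sum]
      simp only [map_smul, smul_eq_mul]
    have hge : f w ≤ f' w := by
      rw [hexp f, hexp f']
      refine Finset.sum_le_sum fun j _ => ?_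
      rw [hf'b]
      by_cases hj : j = k
      · rw [if_pos hj, hj]
        exact mul_le_mul_of_nonpos_left (min_le_left _ _) hle
      · rw [if_neg hj]
    obtain ⟨l, hl⟩ := hcovS f' (hfw.trans_le hge)
    rw [← hbk, hf'b] at hl
    by_cases hlk : l = k
    · rw [if_pos hlk] at hl
      linarith [min_le_right (f (b k)) (-1)]
    · rw [if_neg hlk, hbk] at hl
      linarith [hf l hlk]
  -- Rescale the basis so that `w` has coordinates `(1, 1, 1)`.
  set e : Basis (Fin 3) ℝ E := b.isUnitSMul fun k => (hwpos k).ne'.isUnit with he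
  have hek : ∀ k, e k = b.repr w k • x (a k) := fun k => by
    rw [he, b.isUnitSMul_apply, hbk]
  refine false_of_no_complementary_cover hdeep hcut hsmall a hainj (fun k => hSI (haS k)) e ?_ ?_
  · conv_lhs => rw [← b.sum_repr w]
    simp only [hek, hbk]
  · intro f k
    rw [hek, map_smul, smul_eq_mul]
    exact (mul_nonneg_iff_of_pos_left (hwpos k)).symm

end Decomposition

/-! ### Two simplices around a point of depth three in space -/

section Space

open Module

variable {ι E : Type*} [DecidableEq ι] [NormedAddCommGroup E] [NormedSpace ℝ E]

/-- A cover of one side of the dual space and a cover of the opposite side together surround the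
origin. -/
theorem zeroHull_union_of_covers {w : E} (hw : w ≠ 0) {x : ι → E} {S R : Finset ι}
    (hS : Covers w x S) (hR : Covers (-w) x R) : ZeroHull x (S ∪ R) := by
  refine zeroHull_of_forall_exists_nonneg fun f => ?_
  rcases lt_trichotomy (f w) 0 with h | h | h
  · obtain ⟨i, hi, h0⟩ := hR f (by rw [map_neg]; linarith)
    exact ⟨i, Finset.mem_union_right _ hi, h0⟩
  · -- On the boundary, perturb `f` so that it becomes positive at `w`.
    by_contra! hneg
    obtain ⟨g, hg⟩ : ∃ g : E →ₗ[ℝ] ℝ, 0 < g w := by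
      by_contra! hall
      refine hw ((forall_dual_apply_eq_zero_iff ℝ w).1 fun g => ?_)
      have h2 := hall (-g)
      rw [LinearMap.neg_apply] at h2
      exact le_antisymm (hall g) (by linarith)
    have hev : ∀ᶠ ε : ℝ in nhdsWithin 0 (Set.Ioi 0), ∀ d ∈ S, f (x d) + ε * g (x d) < 0 := by
      rw [Filter.eventually_all_finset]
      intro d hd
      have : Filter.Tendsto (fun ε : ℝ => f (x d) + ε * g (x d)) (nhds 0)
          (nhds (f (x d) + 0 * g (x d))) :=
        (by fun_prop : Continuous fun ε : ℝ => f (x d) + ε * g (x d)).tendsto 0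
      rw [zero_mul, add_zero] at this
      exact (this.mono_left nhdsWithin_le_nhds).eventually
        (gt_mem_nhds (hneg d (Finset.mem_union_left _ hd)))
    obtain ⟨ε, hε, hε0⟩ := (hev.and self_mem_nhdsWithin).exists
    replace hε0 : 0 < ε := hε0
    obtain ⟨i, hi, h0⟩ := hS (f + ε • g) (by simp [h, hg, hε0])
    simp only [LinearMap.add_apply, LinearMap.smul_apply, smul_eq_mul] at h0
    linarith [hε i hi]
  · obtain ⟨i, hi, h0⟩ := hS f h
    exact ⟨i, Finset.mem_union_left _ hi, h0⟩

variable [FiniteDimensional ℝ E]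

omit [DecidableEq ι] in
/-- If no `finrank ℝ E + 1` half-spaces with at most `e` members can exhaust the family, then the
inner normals of all such half-spaces lie in one open half-space: by Carathéodory's theorem the
origin is not in their convex hull, which is open. -/
theorem exists_direction_of_shallow (x : ι → E) (I : Finset ι) (e : ℕ)
    (hI : (finrank ℝ E + 1) * e < I.card) :
    ∃ w : E, ∀ f : E →ₗ[ℝ] ℝ, f w ≤ 0 → e + 1 ≤ (I.filter fun i => 0 ≤ f (x i)).card := by
  classical
  set V : Set (E →L[ℝ] ℝ) := {f | (I.filter fun i => 0 ≤ f (x i)).card ≤ e} with hV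
  have hopen : IsOpen V := by
    rw [isOpen_iff_mem_nhds]
    intro f hf
    have hev : ∀ᶠ g : E →L[ℝ] ℝ in nhds f, ∀ i ∈ I, f (x i) < 0 → g (x i) < 0 := by
      rw [Filter.eventually_all_finset]
      intro i _
      by_cases hi : f (x i) < 0
      · have hc : Continuous fun g : E →L[ℝ] ℝ => g (x i) := by fun_prop
        filter_upwards [(hc.tendsto f).eventually (gt_mem_nhds hi)] with g hg _
        exact hg
      · exact Filter.Eventually.of_forall fun g h => absurd h hi
    filter_upwards [hev] with g hg
    refine (Finset.card_le_card fun i hi => ?_).trans hf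
    rw [Finset.mem_filter] at hi ⊢
    refine ⟨hi.1, ?_⟩
    by_contra hlt
    linarith [hg i hi.1 (not_le.1 hlt), hi.2]
  have h0 : (0 : E →L[ℝ] ℝ) ∉ convexHull ℝ V := by
    intro hmem
    obtain ⟨κ, _, z, a, hz, hind, ha, ha1, ha0⟩ := eq_pos_convex_span_of_mem_convexHull hmem
    have hκ : Fintype.card κ ≤ finrank ℝ E + 1 := by
      refine hind.card_le_finrank_succ.trans ?_
      gcongr
      refine (Submodule.finrank_le _).trans (le_of_eq ?_)
      rw [← (LinearMap.toContinuousLinearMap (𝕜 := ℝ) (E := E) (F' := ℝ)).finrank_eq]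
      exact Subspace.dual_finrank_eq
    have hsub : I ⊆ Finset.univ.biUnion fun k => I.filter fun i => 0 ≤ z k (x i) := by
      intro i hi
      by_contra hno
      simp only [Finset.mem_biUnion, Finset.mem_univ, true_and, Finset.mem_filter, not_exists,
        not_and, not_le] at hno
      have hs : ∑ k, a k * z k (x i) = 0 := by
        have := congrArg (fun f : E →L[ℝ] ℝ => f (x i)) ha0
        simpa [sum_apply] using this
      have hne : (Finset.univ : Finset κ).Nonempty := by
        by_contra hemp
        rw [Finset.not_nonempty_iff_eq_empty.1 hemp, Finset.sum_empty] at ha1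
        exact zero_ne_one ha1
      have := Finset.sum_neg (fun k _ => mul_neg_of_pos_of_neg (ha k) (hno k hi)) hne
      linarith
    have h1 := (Finset.card_le_card hsub).trans Finset.card_biUnion_le
    have h2 : ∑ k, (I.filter fun i => 0 ≤ z k (x i)).card ≤ ∑ _k : κ, e :=
      Finset.sum_le_sum fun k _ => hz ⟨k, rfl⟩
    rw [Finset.sum_const, Finset.card_univ, smul_eq_mul] at h2
    have h3 := Nat.mul_le_mul_right e hκ
    omega
  obtain ⟨F, hF⟩ := geometric_hahn_banach_open_point (convex_convexHull ℝ V) hopen.convexHull h0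
  -- The separating functional on the dual space is evaluation at a vector `w`.
  set w : E := (evalEquiv ℝ E).symm
    (F.toLinearMap.comp (LinearMap.toContinuousLinearMap (𝕜 := ℝ) (E := E) (F' := ℝ)).toLinearMap)
    with hw
  have hfw : ∀ f : E →ₗ[ℝ] ℝ, f w = F (LinearMap.toContinuousLinearMap f) := by
    intro f
    have : evalEquiv ℝ E w f = F (LinearMap.toContinuousLinearMap f) := by
      rw [hw, LinearEquiv.apply_symm_apply]; rfl
    rw [← this]; rfl
  refine ⟨-w, fun f hf => ?_⟩
  by_contra hlt
  have hfV : LinearMap.toContinuousLinearMap f ∈ V := by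
    change (I.filter fun i => 0 ≤ f (x i)).card ≤ e
    omega
  have := hF _ (subset_convexHull ℝ V hfV)
  rw [map_zero, ← hfw] at this
  rw [map_neg] at hf
  linarith

/-- In space, a point of depth three among at least 37 points lies in the hulls of two disjoint
subfamilies. All half-spaces with at most nine points share a direction `w`; on the side of `w` the
threefold cover decomposes, and on the other side there are points in abundance. -/
theorem Deep.splits_two (hE : finrank ℝ E = 3) {x : ι → E} {I : Finset ι} (h : Deep x I 3)
    (hI : 37 ≤ I.card) : Splits x I 2 := by
  -- The constants: `37 = (3 + 1) * 9 + 1` members give a direction in which half-spaces have at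
  -- least `10 = 3 + 3 + 3 + 1` members, enough for two disjoint covers of `-w` that avoid three
  -- members of each of the two covers of `w`.
  obtain ⟨w, hw⟩ := exists_direction_of_shallow x I 9 (by rw [hE]; omega)
  by_cases hw0 : w = 0
  · have h10 : Deep x I 10 := fun f => hw f (by rw [hw0, map_zero])
    have h4 : Deep x I (3 * 1 + 1) := fun f => le_trans (by norm_num) (h10 f)
    exact h4.splits (by norm_num) ((Submodule.finrank_le _).trans hE.le)
  -- `G` and `G'` are disjoint covers of `w`, and `R` and the remainder are disjoint covers of `-w`.
  obtain ⟨S, hSI, hS, hS'⟩ := exists_complementary_covers hE hw0 (x := x) (I := I) fun f _ => h f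
  obtain ⟨G, hGS, hG3, hG⟩ := hS.exists_card_le_three hE hw0
  obtain ⟨G', hGS', hG3', hG'⟩ := hS'.exists_card_le_three hE hw0
  have hY : ∀ f : E →ₗ[ℝ] ℝ, 0 < f (-w) →
      4 ≤ (((I \ G) \ G').filter fun i => 0 ≤ f (x i)).card := by
    intro f hf
    rw [map_neg] at hf
    exact card_filter_sdiff_ge _ G' _ 7 3
      (card_filter_sdiff_ge I G _ 10 3 (hw f (by linarith))
        ((Finset.card_filter_le _ _).trans hG3))
      ((Finset.card_filter_le _ _).trans hG3')
  have hcov : Covers (-w) x ((I \ G) \ G') := by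
    intro f hf
    obtain ⟨i, hi⟩ := Finset.card_pos.1 (lt_of_lt_of_le (by norm_num) (hY f hf))
    exact ⟨i, (Finset.mem_filter.1 hi).1, (Finset.mem_filter.1 hi).2⟩
  obtain ⟨R, hRY, hR3, hR⟩ := hcov.exists_card_le_three hE (neg_ne_zero.2 hw0)
  have hR' : Covers (-w) x (((I \ G) \ G') \ R) := by
    intro f hf
    have := card_filter_sdiff_ge _ R _ 4 3 (hY f hf) ((Finset.card_filter_le _ _).trans hR3)
    obtain ⟨i, hi⟩ := Finset.card_pos.1 (lt_of_lt_of_le (by norm_num) this)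
    exact ⟨i, (Finset.mem_filter.1 hi).1, (Finset.mem_filter.1 hi).2⟩
  refine ⟨G ∪ R, Finset.union_subset (hGS.trans hSI) (hRY.trans ?_),
    zeroHull_union_of_covers hw0 hG hR, G' ∪ (((I \ G) \ G') \ R), ?_,
    zeroHull_union_of_covers hw0 hG' hR', trivial⟩
  · exact Finset.sdiff_subset.trans Finset.sdiff_subset
  · intro i hi
    rcases Finset.mem_union.1 hi with hi | hi
    · have h1 := Finset.mem_sdiff.1 (hGS' hi)
      refine Finset.mem_sdiff.2 ⟨h1.1, fun h2 => ?_⟩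
      rcases Finset.mem_union.1 h2 with h2 | h2
      · exact h1.2 (hGS h2)
      · exact (Finset.mem_sdiff.1 (hRY h2)).2 hi
    · simp only [Finset.mem_sdiff, Finset.mem_union] at hi ⊢
      tauto

/-- In space, a point of depth `3 * (s + 1)` among sufficiently many points lies in the hulls of
`s + 2` disjoint subfamilies. -/
theorem Deep.splits_add_two (hE : finrank ℝ E = 3) {x : ι → E} {I : Finset ι} {s : ℕ}
    (h : Deep x I (3 * (s + 1))) (hI : 37 + 4 * s ≤ I.card) : Splits x I (s + 2) := by
  rw [add_comm s 2]
  exact Deep.splits_add (d := 3) (by norm_num) (D := 3) (n := 37) (by norm_num)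
    (fun J _ hJ hn => hJ.splits_two hE hn) s I ((Submodule.finrank_le _).trans hE.le) h hI

end Space

/-! ### Deep points in the plane -/

section Plane

open Module

theorem Splits.of_family {ι E : Type*} [DecidableEq ι] [AddCommGroup E] [Module ℝ E] {x : ι → E}
    {r : ℕ} {T : ℕ → Finset ι} (h0 : ∀ j < r, ZeroHull x (T j))
    (hdisj : ∀ j < r, ∀ k < r, j ≠ k → Disjoint (T j) (T k)) :
    ∀ {I : Finset ι}, (∀ j < r, T j ⊆ I) → Splits x I r := by
  induction r with
  | zero => intros; trivial
  | succ r ih =>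
    intro I hI
    refine ⟨T r, hI r r.lt_succ_self, h0 r r.lt_succ_self, ih (fun j hj => h0 j (by omega))
      (fun j hj k hk => hdisj j (by omega) k (by omega)) fun j hj => ?_⟩
    exact Finset.subset_sdiff.2 ⟨hI j (by omega), hdisj j (by omega) r (by omega) (by omega)⟩

/-- A sinusoid that is negative at both ends of an interval and nonnegative somewhere in between
needs an interval longer than half a period. -/
theorem pi_lt_of_sinusoid_neg_nonneg_neg {A B α β γ : ℝ} (hαβ : α ≤ β) (hβγ : β ≤ γ)
    (hα : A * Real.cos α + B * Real.sin α < 0) (hβ : 0 ≤ A * Real.cos β + B * Real.sin β)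
    (hγ : A * Real.cos γ + B * Real.sin γ < 0) : Real.pi < γ - α := by
  by_contra! hle
  have s1 := Real.sin_nonneg_of_nonneg_of_le_pi (sub_nonneg.2 (hαβ.trans hβγ)) hle
  have s2 := Real.sin_nonneg_of_nonneg_of_le_pi (sub_nonneg.2 hβγ) (by linarith)
  have s3 := Real.sin_nonneg_of_nonneg_of_le_pi (sub_nonneg.2 hαβ) (by linarith)
  have hid : Real.sin (γ - α) * (A * Real.cos β + B * Real.sin β) =
      Real.sin (γ - β) * (A * Real.cos α + B * Real.sin α) +
        Real.sin (β - α) * (A * Real.cos γ + B * Real.sin γ) := by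
    rw [Real.sin_sub, Real.sin_sub, Real.sin_sub]; ring
  have m1 := mul_nonneg s1 hβ
  have m2 := mul_nonpos_of_nonneg_of_nonpos s2 hα.le
  have m3 := mul_nonpos_of_nonneg_of_nonpos s3 hγ.le
  have z2 := (mul_eq_zero.1 (show Real.sin (γ - β) * _ = 0 by linarith)).resolve_right hα.ne
  have z3 := (mul_eq_zero.1 (show Real.sin (β - α) * _ = 0 by linarith)).resolve_right hγ.ne
  have hne1 : β ≠ α := by rintro rfl; linarith
  have hne2 : γ ≠ β := by rintro rfl; linarith
  have l2 : Real.pi ≤ γ - β := by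
    by_contra! hlt
    exact (Real.sin_pos_of_pos_of_lt_pi (sub_pos.2 (lt_of_le_of_ne hβγ hne2.symm)) hlt).ne' z2
  have l3 : Real.pi ≤ β - α := by
    by_contra! hlt
    exact (Real.sin_pos_of_pos_of_lt_pi (sub_pos.2 (lt_of_le_of_ne hαβ hne1.symm)) hlt).ne' z3
  linarith [Real.pi_pos]

/-- Over one period, the angles where a sinusoid is nonnegative do not interlace with those where it
is negative. -/
theorem false_of_sinusoid_alternating {A B a b c d : ℝ} (hbc : b ≤ c) (hcd : c ≤ d)
    (ha : a ≤ b ∨ d ≤ a) (h1 : d < a + 2 * Real.pi) (h2 : a < b + 2 * Real.pi)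
    (fa : 0 ≤ A * Real.cos a + B * Real.sin a) (fb : A * Real.cos b + B * Real.sin b < 0)
    (fc : 0 ≤ A * Real.cos c + B * Real.sin c) (fd : A * Real.cos d + B * Real.sin d < 0) :
    False := by
  have hbd := pi_lt_of_sinusoid_neg_nonneg_neg hbc hcd fb fc fd
  have fb' : A * Real.cos (b + 2 * Real.pi) + B * Real.sin (b + 2 * Real.pi) < 0 := by
    rwa [Real.cos_add_two_pi, Real.sin_add_two_pi]
  rcases ha with ha | ha
  · have fa' : 0 ≤ A * Real.cos (a + 2 * Real.pi) + B * Real.sin (a + 2 * Real.pi) := by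
      rwa [Real.cos_add_two_pi, Real.sin_add_two_pi]
    linarith [pi_lt_of_sinusoid_neg_nonneg_neg h1.le (by linarith) fd fa' fb']
  · linarith [pi_lt_of_sinusoid_neg_nonneg_neg ha h2.le fd fa fb']

variable {ι : Type*} [DecidableEq ι]

/-- If exactly `3 * M` nonzero vectors of the plane surround the origin with depth `M`, sort them by
angle: the triangles formed by the `i`-th, `(i + M)`-th and `(i + 2 * M)`-th contain the origin,
since a half-plane avoiding one of them meets the family inside an arc of at most `M - 1` members.
-/
theorem Deep.splits_plane_of_card_eq {x : ι → Fin 2 → ℝ} {I : Finset ι} {M : ℕ}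
    (h : Deep x I M) (hI : I.card = 3 * M) (hx : ∀ i ∈ I, x i ≠ 0) : Splits x I M := by
  set z : ι → ℂ := fun i => ⟨x i 0, x i 1⟩ with hz
  -- A functional is a positive multiple of a sinusoid in the angle `θ`, and `y` lists the members
  -- by increasing angle.
  set θ : ι → ℝ := fun i => (z i).arg with hθ
  set y₀ : Fin (3 * M) → ι := fun k => ((I.equivFinOfCardEq hI).symm k : ι) with hy₀
  set y : Fin (3 * M) → ι := y₀ ∘ Tuple.sort (θ ∘ y₀) with hy
  have hmono : ∀ k l, k ≤ l → θ (y k) ≤ θ (y l) := fun k l hkl =>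
    Tuple.monotone_sort (θ ∘ y₀) hkl
  have hinj : Function.Injective y :=
    (Subtype.val_injective.comp (I.equivFinOfCardEq hI).symm.injective).comp (Equiv.injective _)
  have hyI : ∀ k, y k ∈ I := fun k => ((I.equivFinOfCardEq hI).symm _).2
  have hsurj : ∀ i ∈ I, ∃ k, y k = i := by
    intro i hi
    refine ⟨(Tuple.sort (θ ∘ y₀)).symm (I.equivFinOfCardEq hI ⟨i, hi⟩), ?_⟩
    simp [hy, hy₀]
  have hr : ∀ k, 0 < ‖z (y k)‖ := by
    intro k
    refine norm_pos_iff.2 fun h0 => hx _ (hyI k) ?_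
    have h0' := Complex.ext_iff.1 h0
    funext l
    fin_cases l
    · simpa [hz] using h0'.1
    · simpa [hz] using h0'.2
  have hf : ∀ (f : (Fin 2 → ℝ) →ₗ[ℝ] ℝ), ∃ A B : ℝ, ∀ k,
      f (x (y k)) = ‖z (y k)‖ * (A * Real.cos (θ (y k)) + B * Real.sin (θ (y k))) := by
    intro f
    refine ⟨f (Pi.single 0 1), f (Pi.single 1 1), fun k => ?_⟩
    have h1 := Complex.norm_mul_cos_arg (z (y k))
    have h2 := Complex.norm_mul_sin_arg (z (y k))
    have h3 : f (x (y k)) = x (y k) 0 * f (Pi.single 0 1) + x (y k) 1 * f (Pi.single 1 1) := by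
      conv_lhs => rw [show x (y k) = x (y k) 0 • Pi.single 0 1 + x (y k) 1 • Pi.single 1 1 by
        funext l; fin_cases l <;> simp]
      rw [map_add, map_smul, map_smul, smul_eq_mul, smul_eq_mul]
    rw [h3]
    change (z (y k)).re * _ + (z (y k)).im * _ = _
    rw [← h1, ← h2]
    ring
  have hrange : ∀ k, -Real.pi < θ (y k) ∧ θ (y k) ≤ Real.pi := fun k =>
    ⟨Complex.neg_pi_lt_arg _, Complex.arg_le_pi _⟩
  have halt : ∀ (f : (Fin 2 → ℝ) →ₗ[ℝ] ℝ) (a b c d : Fin (3 * M)), b ≤ c → c ≤ d →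
      (a ≤ b ∨ d ≤ a) → 0 ≤ f (x (y a)) → f (x (y b)) < 0 → 0 ≤ f (x (y c)) → f (x (y d)) < 0 →
      False := by
    intro f a b c d hbc hcd ha fa fb fc fd
    obtain ⟨A, B, hAB⟩ := hf f
    rw [hAB] at fa fb fc fd
    have ra := hrange a
    have rb := hrange b
    have rd := hrange d
    exact false_of_sinusoid_alternating (hmono b c hbc) (hmono c d hcd)
      (ha.imp (hmono a b) (hmono d a)) (by linarith) (by linarith)
      (nonneg_of_mul_nonneg_right fa (hr a)) (neg_of_mul_neg_right fb (hr b).le)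
      (nonneg_of_mul_nonneg_right fc (hr c)) (neg_of_mul_neg_right fd (hr d).le)
  rcases Nat.eq_zero_or_pos M with rfl | hM
  · trivial
  set Y : ℕ → ι := fun n => if hn : n < 3 * M then y ⟨n, hn⟩ else y ⟨0, by omega⟩ with hY
  have hYy : ∀ n (hn : n < 3 * M), Y n = y ⟨n, hn⟩ := fun n hn => by simp [hY, hn]
  have hYinj : ∀ m < 3 * M, ∀ n < 3 * M, Y m = Y n → m = n := by
    intro m hm n hn hmn
    rw [hYy m hm, hYy n hn] at hmn
    simpa using hinj hmn
  refine Splits.of_family (T := fun i => {Y i, Y (i + M), Y (i + 2 * M)}) ?_ ?_ ?_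
  · intro i hi
    refine zeroHull_of_forall_exists_nonneg fun f => ?_
    by_contra! hneg
    have hn1 : f (x (y ⟨i, by omega⟩)) < 0 := by rw [← hYy]; exact hneg _ (by simp)
    have hn2 : f (x (y ⟨i + M, by omega⟩)) < 0 := by rw [← hYy]; exact hneg _ (by simp)
    have hn3 : f (x (y ⟨i + 2 * M, by omega⟩)) < 0 := by rw [← hYy]; exact hneg _ (by simp)
    set J : Finset (Fin (3 * M)) := Finset.univ.filter fun k => 0 ≤ f (x (y k)) with hJ
    have hJcard : M ≤ J.card := by
      refine (h f).trans ((Finset.card_le_card fun t ht => ?_).trans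
        (Finset.card_image_le (s := J) (f := y)))
      obtain ⟨htI, ht0⟩ := Finset.mem_filter.1 ht
      obtain ⟨k, rfl⟩ := hsurj t htI
      exact Finset.mem_image_of_mem y (by simpa [hJ] using ht0)
    have hJmem : ∀ k, k ∈ J ↔ 0 ≤ f (x (y k)) := fun k => by simp [hJ]
    have hcount : ∀ K : Finset ℕ, (∀ k ∈ J, (k : ℕ) ∈ K) → M ≤ K.card := by
      intro K hK
      refine hJcard.trans ?_
      rw [← Finset.card_image_of_injective J Fin.val_injective]
      exact Finset.card_le_card fun n hn => by
        obtain ⟨k, hk, rfl⟩ := Finset.mem_image.1 hn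
        exact hK k hk
    have hne : ∀ k ∈ J, (k : ℕ) ≠ i ∧ (k : ℕ) ≠ i + M ∧ (k : ℕ) ≠ i + 2 * M := by
      intro k hk
      rw [hJmem] at hk
      refine ⟨?_, ?_, ?_⟩ <;> intro hki
      · rw [show k = ⟨i, by omega⟩ from Fin.ext hki] at hk; linarith
      · rw [show k = ⟨i + M, by omega⟩ from Fin.ext hki] at hk; linarith
      · rw [show k = ⟨i + 2 * M, by omega⟩ from Fin.ext hki] at hk; linarith
    -- If a member of `J` lies between two consecutive vertices, then all do, as signs do not
    -- interlace; but only `M - 1` members lie in between.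
    have hgap : ∀ b (hb : b + M < 3 * M), f (x (y ⟨b, by omega⟩)) < 0 →
        f (x (y ⟨b + M, hb⟩)) < 0 → ∀ k ∈ J, ¬ (b < (k : ℕ) ∧ (k : ℕ) < b + M) := by
      rintro b hb fb fd c hc ⟨hc1, hc2⟩
      have h1 := hcount (Finset.Ioo b (b + M)) fun a ha => by
        rw [Finset.mem_Ioo]
        by_contra hout
        rw [hJmem] at ha hc
        refine halt f a ⟨b, by omega⟩ c ⟨b + M, hb⟩ (Fin.le_def.2 hc1.le) (Fin.le_def.2 hc2.le)
          ?_ ha fb hc fd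
        rw [Fin.le_def, Fin.le_def]
        change (a : ℕ) ≤ b ∨ b + M ≤ (a : ℕ)
        omega
      rw [Nat.card_Ioo] at h1
      omega
    have h1 := hcount (Finset.range i ∪ Finset.Ioo (i + 2 * M) (3 * M)) fun k hk => by
      have g1 := hgap i (by omega) hn1 hn2 k hk
      have g2 := hgap (i + M) (by omega) hn2 (by
        have : i + M + M = i + 2 * M := by ring
        simpa only [this] using hn3) k hk
      have g3 := hne k hk
      have := k.2
      rw [Finset.mem_union, Finset.mem_range, Finset.mem_Ioo]
      omega
    have h2 := Finset.card_union_le (Finset.range i) (Finset.Ioo (i + 2 * M) (3 * M))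
    rw [Finset.card_range, Nat.card_Ioo] at h2
    omega
  · intro i hi j hj hij
    rw [Finset.disjoint_left]
    intro t ht ht'
    simp only [Finset.mem_insert, Finset.mem_singleton] at ht ht'
    rcases ht with rfl | rfl | rfl <;> rcases ht' with ht' | ht' | ht' <;>
      (have := hYinj _ (by omega) _ (by omega) ht'; omega)
  · intro i hi t ht
    simp only [Finset.mem_insert, Finset.mem_singleton] at ht
    rcases ht with rfl | rfl | rfl
    · rw [hYy i (by omega)]; exact hyI _
    · rw [hYy (i + M) (by omega)]; exact hyI _
    · rw [hYy (i + 2 * M) (by omega)]; exact hyI _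

/-- Among more than `3 * M` vectors of the plane surrounding the origin with depth `M`, one can be
omitted. Otherwise the half-planes with at most `M` members would exhaust the family, while by
Helly's theorem either three of them, or the two extreme ones in an open half-plane of normals,
already contain the whole union. -/
theorem Deep.exists_erase_plane {x : ι → Fin 2 → ℝ} {I : Finset ι} {M : ℕ}
    (h : Deep x I M) (hI : 3 * M < I.card) : ∃ i ∈ I, Deep x (I.erase i) M := by
  by_contra! hno
  -- Each member `i` lies in a half-plane `0 ≤ f i` with at most `M` members.
  have hex : ∀ i, ∃ f : (Fin 2 → ℝ) →ₗ[ℝ] ℝ, i ∈ I → 0 ≤ f (x i) ∧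
      (I.filter fun j => 0 ≤ f (x j)).card ≤ M := by
    intro i
    by_cases hi : i ∈ I
    · have := hno i hi
      unfold Deep at this
      push Not at this
      obtain ⟨f, hf⟩ := this
      refine ⟨f, fun _ => ?_⟩
      have hfI := h f
      rw [Finset.filter_erase] at hf
      have hmem : i ∈ I.filter fun j => 0 ≤ f (x j) := by
        by_contra hn
        rw [Finset.erase_eq_of_notMem hn] at hf
        omega
      rw [Finset.card_erase_of_mem hmem] at hf
      exact ⟨(Finset.mem_filter.1 hmem).2, by omega⟩
    · exact ⟨0, fun h => absurd h hi⟩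
  choose f hf using hex
  -- Any three of these half-planes miss a member, so by Helly's theorem all of them miss some `w`.
  obtain ⟨w, hw⟩ : (⋂ i ∈ I, {v : Fin 2 → ℝ | f i v < 0}).Nonempty := by
    refine Convex.helly_theorem' (𝕜 := ℝ) (F := fun i => {v : Fin 2 → ℝ | f i v < 0})
      (fun i _ => convex_halfSpace_lt (f i).isLinear 0) fun G hG hcard => ?_
    rw [finrank_fin_fun] at hcard
    obtain ⟨j, hjI, hj⟩ : ∃ j ∈ I, j ∉ G.biUnion fun i => I.filter fun j => 0 ≤ f i (x j) := by
      by_contra! hall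
      have h1 := (Finset.card_le_card (s := I) hall).trans Finset.card_biUnion_le
      have h2 : ∑ i ∈ G, (I.filter fun j => 0 ≤ f i (x j)).card ≤ ∑ _i ∈ G, M :=
        Finset.sum_le_sum fun i hi => (hf i (hG hi)).2
      rw [Finset.sum_const, smul_eq_mul] at h2
      have h3 := Nat.mul_le_mul_right M hcard
      omega
    refine ⟨x j, Set.mem_iInter₂.2 fun i hi => ?_⟩
    by_contra hneg
    exact hj (Finset.mem_biUnion.2 ⟨i, hi, Finset.mem_filter.2 ⟨hjI, not_lt.1 hneg⟩⟩)
  have hw : ∀ i ∈ I, f i w < 0 := fun i hi => Set.mem_iInter₂.1 hw i hi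
  set u : Fin 2 → ℝ := ![-w 1, w 0] with hu
  have hIne : I.Nonempty := Finset.card_pos.1 (by omega)
  have hN : 0 < w 0 ^ 2 + w 1 ^ 2 := by
    obtain ⟨i, hi⟩ := hIne
    by_contra hle
    have h0 : w 0 = 0 := by nlinarith [sq_nonneg (w 0), sq_nonneg (w 1)]
    have h1 : w 1 = 0 := by nlinarith [sq_nonneg (w 0), sq_nonneg (w 1)]
    have : w = 0 := by funext l; fin_cases l <;> simp [h0, h1]
    have := hw i hi
    simp_all
  -- The position of the `i`-th normal on the line `f w = -1`.
  set t : ι → ℝ := fun i => f i u / (-f i w) with ht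
  have hdecomp : ∀ i ∈ I, ∀ v : Fin 2 → ℝ, f i v = (-f i w) / (w 0 ^ 2 + w 1 ^ 2) *
      (-(w 0 * v 0 + w 1 * v 1) + (w 0 * v 1 - w 1 * v 0) * t i) := by
    intro i hi v
    have hv : v = ((w 0 * v 0 + w 1 * v 1) / (w 0 ^ 2 + w 1 ^ 2)) • w +
        ((w 0 * v 1 - w 1 * v 0) / (w 0 ^ 2 + w 1 ^ 2)) • u := by
      funext l
      fin_cases l
      · simp [hu]; field_simp; ring
      · simp [hu]; field_simp; ring
    have hne : f i w ≠ 0 := (hw i hi).ne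
    conv_lhs => rw [hv, map_add, map_smul, map_smul, smul_eq_mul, smul_eq_mul]
    simp only [ht]
    field_simp
    ring
  have hpos : ∀ i ∈ I, 0 < (-f i w) / (w 0 ^ 2 + w 1 ^ 2) := fun i hi =>
    div_pos (neg_pos.2 (hw i hi)) hN
  -- The two extreme half-planes cover all the others, and so the whole family; but together they
  -- have at most `2 * M` members.
  obtain ⟨i₁, hi₁, hmax⟩ := I.exists_max_image t hIne
  obtain ⟨i₂, hi₂, hmin⟩ := I.exists_min_image t hIne
  have hsub : I ⊆ (I.filter fun j => 0 ≤ f i₁ (x j)) ∪ I.filter fun j => 0 ≤ f i₂ (x j) := by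
    intro i hi
    have h0 := (hf i hi).1
    rw [hdecomp i hi] at h0
    have h0' := nonneg_of_mul_nonneg_right h0 (hpos i hi)
    rw [Finset.mem_union, Finset.mem_filter, Finset.mem_filter, hdecomp i₁ hi₁, hdecomp i₂ hi₂]
    rcases le_total 0 (w 0 * x i 1 - w 1 * x i 0) with hβ | hβ
    · refine Or.inl ⟨hi, mul_nonneg (hpos i₁ hi₁).le ?_⟩
      linarith [mul_le_mul_of_nonneg_left (hmax i hi) hβ]
    · refine Or.inr ⟨hi, mul_nonneg (hpos i₂ hi₂).le ?_⟩
      linarith [mul_le_mul_of_nonpos_left (hmin i hi) hβ]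
  have h1 := (Finset.card_le_card hsub).trans (Finset.card_union_le _ _)
  have h2 := (hf i₁ hi₁).2
  have h3 := (hf i₂ hi₂).2
  omega

/-- In the plane, a point of depth `M` among at least `3 * M` points lies in the hulls of `M`
disjoint subfamilies. -/
theorem Deep.splits_plane {x : ι → Fin 2 → ℝ} (n : ℕ) : ∀ {I : Finset ι} {M : ℕ}, I.card = n →
    Deep x I M → 3 * M ≤ I.card → Splits x I M := by
  induction n with
  | zero =>
    intro I M hn _ hI
    have : M = 0 := by omega
    subst this
    trivial
  | succ n ih =>
    intro I M hn h hI
    rcases M with _ | M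
    · trivial
    -- A member at the origin is a part by itself. Otherwise members are omitted until `3 * M` are
    -- left.
    by_cases hx : ∃ i ∈ I, x i = 0
    · obtain ⟨i, hi, hxi⟩ := hx
      refine ⟨{i}, by simpa using hi, subset_convexHull ℝ _ ⟨i, by simp, hxi⟩, ih ?_ ?_ ?_⟩
      · rw [Finset.card_sdiff_of_subset (by simpa using hi), Finset.card_singleton, hn]; rfl
      · intro f
        exact card_filter_sdiff_ge I {i} _ (M + 1) 1 (h f)
          ((Finset.card_filter_le _ _).trans (Finset.card_singleton i).le)
      · rw [Finset.card_sdiff_of_subset (by simpa using hi), Finset.card_singleton]; omega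
    push Not at hx
    rcases hI.eq_or_lt with heq | hlt
    · exact h.splits_plane_of_card_eq heq.symm hx
    · obtain ⟨i, hi, hdeep⟩ := h.exists_erase_plane hlt
      have hcard : (I.erase i).card = n := by rw [Finset.card_erase_of_mem hi, hn]; rfl
      exact (ih hcard hdeep (by omega)).mono (Finset.erase_subset i I)

end Plane

/-! ### Helly bounds and deep points -/

section Helly

open Module

/-- `IsHellyBound S h`: the positive integer `h` has the property required of the Helly number
of `S`. -/
def IsHellyBound {E : Type*} [AddCommGroup E] [Module ℝ E] (S : Set E) (h : ℕ) : Prop :=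
  0 < h ∧ ∀ F : Finset (Set E), (∀ C ∈ F, Convex ℝ C) →
    (∀ G ⊆ F, G.card ≤ h → ((⋂ C ∈ G, C) ∩ S).Nonempty) → ((⋂ C ∈ F, C) ∩ S).Nonempty

theorem exists_isHellyBound_of_lt_top {E : Type*} [AddCommGroup E] [Module ℝ E] {S : Set E}
    (h : hellyNumber S < ⊤) : ∃ n : ℕ, IsHellyBound S n ∧ hellyNumber S = n := by
  have hne : {n | IsHellyBound S n}.Nonempty := by
    by_contra hemp
    refine h.ne (iInf₂_eq_top.2 fun n hn => ?_)
    exact (hemp ⟨n, hn⟩).elim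
  refine ⟨sInf {n | IsHellyBound S n}, Nat.sInf_mem hne, le_antisymm ?_ ?_⟩
  · exact iInf₂_le _ (Nat.sInf_mem hne)
  · exact le_iInf₂ fun n hn => Nat.cast_le.2 (Nat.sInf_le hn)

theorem IsHellyBound.inter_nonempty {E κ : Type*} [AddCommGroup E] [Module ℝ E] {S : Set E} {h : ℕ}
    (hS : IsHellyBound S h) (K : Finset κ) (C : κ → Set E) (hC : ∀ i ∈ K, Convex ℝ (C i))
    (hJ : ∀ J ⊆ K, J.card ≤ h → ((⋂ i ∈ J, C i) ∩ S).Nonempty) :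
    ((⋂ i ∈ K, C i) ∩ S).Nonempty := by
  classical
  have := hS.2 (K.image C) (by simpa using hC) fun G hG hcard => ?_
  · simpa using this
  · have hg : ∀ X : G, ∃ i ∈ K, C i = X := fun X => by simpa using hG X.2
    choose g hgK hgC using hg
    obtain ⟨p, hp, hpS⟩ := hJ (Finset.univ.image g) (by
      intro i hi
      obtain ⟨X, -, rfl⟩ := Finset.mem_image.1 hi
      exact hgK X) (Finset.card_image_le.trans (by simpa using hcard))
    refine ⟨p, Set.mem_iInter₂.2 fun X hX => ?_, hpS⟩
    have := Set.mem_iInter₂.1 hp (g ⟨X, hX⟩) (Finset.mem_image_of_mem g (Finset.mem_univ _))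
    rwa [hgC] at this

/-- Centre points: among more than `h * (D - 1)` points of a set with Helly bound `h`, the set has a
point of depth `D`, obtained as a common point of the hulls of all subfamilies missing at most
`D - 1` points. -/
theorem IsHellyBound.exists_deep {E ι : Type*} [NormedAddCommGroup E] [NormedSpace ℝ E]
    [Fintype ι] {S : Set E} {h D : ℕ} (hS : IsHellyBound S h) {x : ι → E} (hx : ∀ i, x i ∈ S)
    (hn : h * D < Fintype.card ι) :
    ∃ p ∈ S, Deep (fun i => x i - p) Finset.univ (D + 1) := by
  classical
  obtain ⟨p, hp, hpS⟩ := hS.inter_nonempty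
    (Finset.univ.filter fun I : Finset ι => (Iᶜ).card ≤ D)
    (fun I => convexHull ℝ (x '' (I : Set ι))) (fun I _ => convex_convexHull ℝ _) (by
    intro J hJ hcard
    obtain ⟨i, hi⟩ : ∃ i, i ∉ J.biUnion fun I => Iᶜ := by
      by_contra! hall
      have h1 : (Finset.univ : Finset ι).card ≤ (J.biUnion fun I => Iᶜ).card :=
        Finset.card_le_card fun i _ => hall i
      have h2 : ∑ I ∈ J, (Iᶜ).card ≤ ∑ _I ∈ J, D :=
        Finset.sum_le_sum fun I hI => (Finset.mem_filter.1 (hJ hI)).2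
      have h3 := Finset.card_biUnion_le (s := J) (t := fun I : Finset ι => Iᶜ)
      rw [Finset.sum_const, smul_eq_mul] at h2
      have h4 := Nat.mul_le_mul_right D hcard
      rw [Finset.card_univ] at h1
      omega
    refine ⟨x i, Set.mem_iInter₂.2 fun I hI => subset_convexHull ℝ _ ⟨i, ?_, rfl⟩, hx i⟩
    by_contra hiI
    exact hi (Finset.mem_biUnion.2 ⟨I, hI, Finset.mem_compl.2 (by exact_mod_cast hiI)⟩))
  refine ⟨p, hpS, fun f => ?_⟩
  by_contra hlt
  change ¬ D + 1 ≤ (Finset.univ.filter fun i => 0 ≤ f (x i - p)).card at hlt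
  set I : Finset ι := (Finset.univ.filter fun i => 0 ≤ f (x i - p))ᶜ with hI
  have hmem := Set.mem_iInter₂.1 hp I (by
    rw [Finset.mem_filter, hI, compl_compl]
    exact ⟨Finset.mem_univ _, by omega⟩)
  obtain ⟨i, hi, h0⟩ := (zeroHull_sub_iff.2 hmem).exists_nonneg f
  rw [hI, Finset.mem_compl] at hi
  exact hi (Finset.mem_filter.2 ⟨Finset.mem_univ _, h0⟩)

end Helly

/-! ### The Helly number of the integer lattice -/

section Lattice

open Module

/-- Anti-exchange: a proper subset of a finite point set that contains every point of its hull can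
be enlarged by a single point so that it keeps this property. -/
theorem exists_insert_hull_closed {E K : Type*} [AddCommGroup E] [Module ℝ E] [Fintype K]
    [DecidableEq K] {φ : K → E} (hφ : Function.Injective φ) {D : Finset K}
    (hD : ∀ z, φ z ∈ convexHull ℝ (φ '' (D : Set K)) → z ∈ D) {z₀ : K} (hz₀ : z₀ ∉ D) :
    ∃ e ∉ D, ∀ z, φ z ∈ convexHull ℝ (φ '' (insert e D : Finset K)) → z ∈ insert e D := by
  classical
  set cl : K → Finset K := fun e =>
    Finset.univ.filter fun z => φ z ∈ convexHull ℝ (φ '' (insert e D : Finset K)) with hcl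
  have hmemcl : ∀ e z, z ∈ cl e ↔ φ z ∈ convexHull ℝ (φ '' (insert e D : Finset K)) := by
    intro e z; simp [hcl]
  obtain ⟨e, he, hmin⟩ := (Finset.univ.filter fun e => e ∉ D).exists_min_image
    (fun e => (cl e).card) ⟨z₀, by simpa using hz₀⟩
  rw [Finset.mem_filter] at he
  refine ⟨e, he.2, fun f hf => ?_⟩
  by_contra hfD
  rw [Finset.mem_insert, not_or] at hfD
  obtain ⟨hfe, hfD⟩ := hfD
  have hsub : cl f ⊆ cl e := by
    intro z hz
    rw [hmemcl] at hz ⊢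
    refine convexHull_min ?_ (convex_convexHull ℝ _) hz
    rintro _ ⟨t, ht, rfl⟩
    rcases Finset.mem_insert.1 (Finset.mem_coe.1 ht) with rfl | ht
    · exact hf
    · exact subset_convexHull ℝ _ ⟨t, by simp [ht], rfl⟩
  have heq := Finset.eq_of_subset_of_card_le hsub (hmin f (by simpa using hfD))
  have hef : φ e ∈ convexHull ℝ (φ '' (insert f D : Finset K)) := by
    rw [← hmemcl, heq, hmemcl]
    exact subset_convexHull ℝ _ ⟨e, by simp, rfl⟩
  rw [Finset.coe_insert, Set.image_insert_eq] at hf hef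
  rcases (D : Set K).eq_empty_or_nonempty with hemp | hne
  · rw [hemp] at hf
    simp only [Set.image_empty, insert_empty_eq, convexHull_singleton, Set.mem_singleton_iff] at hf
    exact hfe (hφ hf)
  rw [convexHull_insert (hne.image φ), convexJoin_singleton_left, Set.mem_iUnion₂] at hf hef
  obtain ⟨u, hu, a, b, ha, hb, hab, hfu⟩ := hf
  obtain ⟨v, hv, a', b', ha', hb', hab', hev⟩ := hef
  have ha1 : a ≤ 1 := by linarith
  have ha1' : a' ≤ 1 := by linarith
  have hle : a * a' ≤ a := mul_le_of_le_one_right ha ha1'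
  have hle' : a * a' ≤ a' := mul_le_of_le_one_left ha' ha1
  rcases (hle.trans ha1).eq_or_lt with h1 | h1
  · have hb0 : b = 0 := by linarith
    have ha0 : a = 1 := by linarith
    rw [hb0, ha0, one_smul, zero_smul, add_zero] at hfu
    exact hfe (hφ hfu.symm)
  · refine he.2 (hD e ?_)
    have hpos : 0 < 1 - a * a' := by linarith
    have hcomb : φ e = ((a' * b) / (1 - a * a')) • u + (b' / (1 - a * a')) • v := by
      have h2 : (1 - a * a') • φ e = (a' * b) • u + b' • v := by
        have : φ e = a' • (a • φ e + b • u) + b' • v := by rw [hfu, hev]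
        rw [sub_smul, one_smul]
        nth_rewrite 1 [this]
        rw [smul_add, smul_smul, smul_smul, mul_comm a' a]
        abel
      calc φ e = (1 - a * a')⁻¹ • ((1 - a * a') • φ e) := by
            rw [smul_smul, inv_mul_cancel₀ hpos.ne', one_smul]
        _ = _ := by rw [h2, smul_add, smul_smul, smul_smul, div_eq_inv_mul, div_eq_inv_mul]
    rw [hcomb]
    refine convex_convexHull ℝ _ hu hv (by positivity) (by positivity) ?_
    rw [← add_div, div_eq_one_iff_eq hpos.ne']
    linear_combination a' * hab + hab'

/-- Doignon's theorem. In a minimal family of convex sets without a common lattice point, the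
lattice points of the sets are enlarged, inside a finite box, as far as possible without creating a
common point. Each set then misses only one further point `e c` of all the others, and two of these
points with the same parities would have a midpoint common to all sets. -/
theorem isHellyBound_integerLattice (j : ℕ) : IsHellyBound (integerLattice j) (2 ^ j) := by
  classical
  refine ⟨by positivity, fun F => ?_⟩
  induction F using Finset.strongInduction with
  | H F ih =>
  intro hconv hG
  by_cases hcard : F.card ≤ 2 ^ j
  · exact hG F subset_rfl hcard
  by_contra hno
  have hsub : ∀ c : F, ∃ z : Fin j → ℤ, ∀ c' : F, c' ≠ c → (fun i => (z i : ℝ)) ∈ c'.1 := by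
    intro c
    obtain ⟨p, hp, hpS⟩ := ih (F.erase c) (Finset.erase_ssubset c.2)
      (fun C hC => hconv C (Finset.mem_of_mem_erase hC))
      fun G hGF => hG G (hGF.trans (Finset.erase_subset _ _))
    choose z hz using hpS
    refine ⟨z, fun c' hc' => ?_⟩
    have h1 : (fun i => (z i : ℝ)) = p := funext fun i => (hz i).symm
    rw [h1]
    exact Set.mem_iInter₂.1 hp c'.1 (Finset.mem_erase.2 ⟨fun h => hc' (Subtype.ext h), c'.2⟩)
  choose z hz using hsub
  have hFne : (Finset.univ : Finset F).Nonempty := by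
    rw [← Finset.card_pos, Finset.card_univ, Fintype.card_coe]
    exact lt_of_le_of_lt (Nat.zero_le _) (not_le.1 hcard)
  set lo : Fin j → ℤ := Finset.univ.inf' hFne z with hlo
  set hi : Fin j → ℤ := Finset.univ.sup' hFne z with hhi
  set K := Finset.Icc lo hi with hK
  have hzK : ∀ c, z c ∈ K := fun c => Finset.mem_Icc.2
    ⟨Finset.inf'_le _ (Finset.mem_univ c), Finset.le_sup' _ (Finset.mem_univ c)⟩
  set φ : K → Fin j → ℝ := fun t i => (t.1 i : ℝ) with hφ
  have hφinj : Function.Injective φ := by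
    intro s t hst
    refine Subtype.ext (funext fun i => ?_)
    have h := congrFun hst i
    simp only [hφ] at h
    exact_mod_cast h
  -- Families of hull-closed sets in the box, without a common point.
  set 𝒟 : Set (F → Finset K) := {D | (∀ c t, φ t ∈ convexHull ℝ (φ '' (D c : Set K)) → t ∈ D c) ∧
    (∀ c c' : F, c' ≠ c → (⟨z c, hzK c⟩ : K) ∈ D c') ∧ ¬ ∃ t, ∀ c, t ∈ D c} with h𝒟
  have hne : 𝒟.Nonempty := by
    refine ⟨fun c => Finset.univ.filter fun t => φ t ∈ c.1, fun c t ht => ?_, fun c c' hc => ?_, ?_⟩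
    · refine Finset.mem_filter.2 ⟨Finset.mem_univ _, convexHull_min ?_ (hconv c.1 c.2) ht⟩
      rintro _ ⟨s, hs, rfl⟩
      exact (Finset.mem_filter.1 (Finset.mem_coe.1 hs)).2
    · exact Finset.mem_filter.2 ⟨Finset.mem_univ _, hz c c' hc⟩
    · rintro ⟨t, ht⟩
      refine hno ⟨φ t, Set.mem_iInter₂.2 fun C hC => ?_, fun i => ⟨t.1 i, rfl⟩⟩
      exact (Finset.mem_filter.1 (ht ⟨C, hC⟩)).2
  -- By maximality of `D`, adding a point `e c` to `D c` that keeps it hull-closed creates a common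
  -- point, which can only be `e c`.
  obtain ⟨D, hD⟩ := 𝒟.toFinite.exists_maximal hne
  obtain ⟨hDcl, hDz, hDno⟩ := hD.prop
  have hexists : ∀ c, ∃ e, e ∉ D c ∧ (∀ c', c' ≠ c → e ∈ D c') ∧
      ∀ t, φ t ∈ convexHull ℝ (φ '' (insert e (D c) : Finset K)) → t ∈ insert e (D c) := by
    intro c
    have hzc : (⟨z c, hzK c⟩ : K) ∉ D c := by
      intro hmem
      refine hDno ⟨⟨z c, hzK c⟩, fun c' => ?_⟩
      by_cases hc : c' = c
      · rw [hc]; exact hmem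
      · exact hDz c c' hc
    obtain ⟨e, he, hecl⟩ := exists_insert_hull_closed hφinj (hDcl c) hzc
    refine ⟨e, he, ?_, hecl⟩
    set D' := Function.update D c (insert e (D c)) with hD'
    have hDD' : D ≤ D' := by
      intro c'
      by_cases hc : c' = c
      · subst hc; rw [hD', Function.update_self]; exact Finset.subset_insert _ _
      · rw [hD', Function.update_of_ne hc]
    have hnot : D' ∉ 𝒟 := by
      intro hmem
      have := hD.le_of_ge hmem hDD' c
      rw [hD', Function.update_self] at this
      exact he (this (Finset.mem_insert_self _ _))
    have hcommon : ∃ t, ∀ c', t ∈ D' c' := by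
      by_contra hnc
      refine hnot ⟨fun c' t ht => ?_, fun a b hab => hDD' b (hDz a b hab), hnc⟩
      by_cases hc : c' = c
      · subst hc
        rw [hD', Function.update_self] at ht ⊢
        exact hecl t ht
      · rw [hD', Function.update_of_ne hc] at ht ⊢
        exact hDcl c' t ht
    obtain ⟨t, ht⟩ := hcommon
    have hto : ∀ c', c' ≠ c → t ∈ D c' := by
      intro c' hc
      have := ht c'
      rwa [hD', Function.update_of_ne hc] at this
    have htc := ht c
    rw [hD', Function.update_self, Finset.mem_insert] at htc
    rcases htc with rfl | htc
    · exact hto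
    · refine absurd ⟨t, fun c' => ?_⟩ hDno
      by_cases hc : c' = c
      · rw [hc]; exact htc
      · exact hto c' hc
  choose e heD heo hecl using hexists
  obtain ⟨a, b, hab, hpar⟩ := Fintype.exists_ne_map_eq_of_card_lt
    (fun (c : F) (i : Fin j) => ((e c).1 i : ZMod 2)) (by
      rw [Fintype.card_fun, ZMod.card, Fintype.card_fin, Fintype.card_coe]; omega)
  have hmid : ∀ i, ∃ m : ℤ, (e a).1 i + (e b).1 i = 2 * m := by
    intro i
    have h1 : (((e a).1 i : ℤ) : ZMod 2) = (((e b).1 i : ℤ) : ZMod 2) := congrFun hpar i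
    rw [ZMod.intCast_eq_intCast_iff_dvd_sub] at h1
    obtain ⟨m, hm⟩ := h1
    exact ⟨m + (e a).1 i, by push_cast at hm; linarith⟩
  choose m hm using hmid
  have hmK : m ∈ K := by
    have h1 := Finset.mem_Icc.1 (e a).2
    have h2 := Finset.mem_Icc.1 (e b).2
    refine Finset.mem_Icc.2 ⟨fun i => ?_, fun i => ?_⟩
    · have g1 : lo i ≤ (e a).1 i := h1.1 i
      have g2 : lo i ≤ (e b).1 i := h2.1 i
      linarith [hm i]
    · have g1 : (e a).1 i ≤ hi i := h1.2 i
      have g2 : (e b).1 i ≤ hi i := h2.2 i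
      linarith [hm i]
  -- The midpoint of `e a` and `e b` belongs to all the sets: to `D a ∪ {e a}` because this set is
  -- hull-closed and contains `e b`, to `D b ∪ {e b}` likewise, and to the others by convexity.
  have hφm : ∀ s : Set K, e a ∈ s → e b ∈ s → φ ⟨m, hmK⟩ ∈ convexHull ℝ (φ '' s) := by
    intro s ha hb
    have : φ ⟨m, hmK⟩ = (1 / 2 : ℝ) • φ (e a) + (1 / 2 : ℝ) • φ (e b) := by
      funext i
      have h1 : (((e a).1 i : ℤ) : ℝ) + (((e b).1 i : ℤ) : ℝ) = 2 * (m i : ℝ) := by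
        exact_mod_cast hm i
      simp only [hφ, Pi.add_apply, Pi.smul_apply, smul_eq_mul]
      linarith
    rw [this]
    exact convex_convexHull ℝ _ (subset_convexHull ℝ _ (Set.mem_image_of_mem φ ha))
      (subset_convexHull ℝ _ (Set.mem_image_of_mem φ hb)) (by norm_num) (by norm_num) (by norm_num)
  have hne : e a ≠ e b := fun h => heD a (h ▸ heo b a hab)
  have hma : (⟨m, hmK⟩ : K) ≠ e a := by
    intro h
    refine hne (Subtype.ext (funext fun i => ?_))
    have h1 : m i = (e a).1 i := by rw [← h]
    have := hm i
    omega
  have hmb : (⟨m, hmK⟩ : K) ≠ e b := by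
    intro h
    refine hne (Subtype.ext (funext fun i => ?_))
    have h1 : m i = (e b).1 i := by rw [← h]
    have := hm i
    omega
  refine hDno ⟨⟨m, hmK⟩, fun c => ?_⟩
  by_cases hca : c = a
  · subst hca
    have := hecl c _ (hφm (insert (e c) (D c) : Finset K) (by simp) (by simp [heo b c hab]))
    exact (Finset.mem_insert.1 this).resolve_left hma
  by_cases hcb : c = b
  · subst hcb
    have := hecl c _ (hφm (insert (e c) (D c) : Finset K) (by simp [heo a c hca]) (by simp))
    exact (Finset.mem_insert.1 this).resolve_left hmb
  · exact hDcl c _ (hφm (D c) (by simpa using heo a c hca) (by simpa using heo b c hcb))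

end Lattice

/-! ### Tverberg's theorem in real space -/

section Tverberg

open Module

theorem ZeroHull.of_injective_map {ι E E' : Type*} [AddCommGroup E] [Module ℝ E]
    [AddCommGroup E'] [Module ℝ E'] (L : E →ₗ[ℝ] E') (hL : Function.Injective L) {x : ι → E}
    {T : Finset ι} (h : ZeroHull (fun i => L (x i)) T) : ZeroHull x T := by
  rw [zeroHull_iff_weights] at h ⊢
  obtain ⟨a, ha, h1, h0⟩ := h
  refine ⟨a, ha, h1, hL ?_⟩
  simpa [map_sum] using h0

theorem ZeroHull.map {ι E E' : Type*} [AddCommGroup E] [Module ℝ E]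
    [AddCommGroup E'] [Module ℝ E'] (L : E →ₗ[ℝ] E') {x : ι → E}
    {T : Finset ι} (h : ZeroHull x T) : ZeroHull (fun i => L (x i)) T := by
  rw [zeroHull_iff_weights] at h ⊢
  obtain ⟨a, ha, h1, h0⟩ := h
  refine ⟨a, ha, h1, ?_⟩
  simpa [map_sum] using congrArg L h0

open scoped InnerProductSpace in
/-- The colourful Carathéodory theorem in an inner product space. A rainbow choice whose hull is
closest to the origin contains the origin: otherwise the closest point already lies in the hull of a
choice omitting one colour, and exchanging the point of that colour brings the hull closer. -/
theorem colorful_caratheodory_inner {ι J E : Type*} [Fintype ι] [Fintype J] [Nonempty J]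
    [NormedAddCommGroup E] [InnerProductSpace ℝ E] [FiniteDimensional ℝ E]
    (hι : finrank ℝ E < Fintype.card ι) (c : ι → J → E)
    (hc : ∀ i, ZeroHull (c i) Finset.univ) :
    ∃ σ : ι → J, ZeroHull (fun i => c i (σ i)) Finset.univ := by
  classical
  have : Nonempty ι := Fintype.card_pos_iff.1 (by omega)
  set K : (ι → J) → Set E := fun σ =>
    convexHull ℝ ((fun i => c i (σ i)) '' ((Finset.univ : Finset ι) : Set ι)) with hK
  have hproj : ∀ σ, ∃ z ∈ K σ, ∀ y ∈ K σ, ‖z‖ ^ 2 ≤ ⟪z, y⟫_ℝ := by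
    intro σ
    have hfin : ((fun i => c i (σ i)) '' ((Finset.univ : Finset ι) : Set ι)).Finite :=
      Finset.univ.finite_toSet.image _
    have hne : (K σ).Nonempty := by
      obtain ⟨i⟩ := ‹Nonempty ι›
      exact ⟨_, subset_convexHull ℝ _ ⟨i, by simp, rfl⟩⟩
    obtain ⟨z, hz, hmin⟩ := exists_norm_eq_iInf_of_complete_convex hne
      (hfin.isCompact_convexHull ℝ).isComplete (convex_convexHull ℝ _) 0
    refine ⟨z, hz, fun y hy => ?_⟩
    have := (norm_eq_iInf_iff_real_inner_le_zero (convex_convexHull ℝ _) hz).1 hmin y hy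
    rw [zero_sub, inner_neg_left, inner_sub_right, real_inner_self_eq_norm_sq] at this
    linarith
  choose z hzK hz using hproj
  obtain ⟨σ, -, hσ⟩ := Finset.exists_min_image Finset.univ (fun σ => ‖z σ‖)
    (Finset.univ_nonempty (α := ι → J))
  refine ⟨σ, ?_⟩
  by_cases hz0 : z σ = 0
  · have := hzK σ
    rwa [hz0] at this
  exfalso
  obtain ⟨T, -, a, ha, h1, h0, hcard⟩ := (zeroHull_sub_iff.2 (hzK σ)).exists_pos_weights
  have hnn : ∀ i, 0 ≤ ⟪z σ, c i (σ i) - z σ⟫_ℝ := by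
    intro i
    rw [inner_sub_right, real_inner_self_eq_norm_sq]
    linarith [hz σ _ (subset_convexHull ℝ _ ⟨i, by simp, rfl⟩)]
  -- The chosen points with positive weight lie in the hyperplane through `z σ` orthogonal to it, so
  -- a Carathéodory simplex omits a colour `i₀`.
  have horth : ∀ i ∈ T, ⟪z σ, c i (σ i) - z σ⟫_ℝ = 0 := by
    have hsum : ∑ i ∈ T, a i * ⟪z σ, c i (σ i) - z σ⟫_ℝ = 0 := by
      have := congrArg (fun y => ⟪z σ, y⟫_ℝ) h0
      simpa [inner_sum, inner_smul_right] using this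
    intro i hi
    have := (Finset.sum_eq_zero_iff_of_nonneg fun i hi => mul_nonneg (ha i hi).le (hnn i)).1 hsum i
      hi
    exact (mul_eq_zero.1 this).resolve_left (ha i hi).ne'
  have hspan : Submodule.span ℝ ((fun i => c i (σ i) - z σ) '' (T : Set ι)) ≤
      (Submodule.span ℝ {z σ})ᗮ := by
    rw [Submodule.span_le]
    rintro _ ⟨i, hi, rfl⟩
    exact Submodule.mem_orthogonal_singleton_iff_inner_right.2 (horth i (by exact_mod_cast hi))
  have hdim := Submodule.finrank_add_finrank_orthogonal (Submodule.span ℝ {z σ})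
  rw [finrank_span_singleton hz0] at hdim
  have hle := Submodule.finrank_mono hspan
  obtain ⟨i₀, hi₀⟩ : ∃ i₀, i₀ ∉ T := by
    by_contra! hall
    rw [Finset.eq_univ_iff_forall.2 hall, Finset.card_univ] at hcard
    rw [Finset.eq_univ_iff_forall.2 hall] at hle
    omega
  obtain ⟨j, -, hj⟩ := (hc i₀).exists_nonneg (-(innerₗ E (z σ)))
  rw [LinearMap.neg_apply, innerₗ_apply_apply] at hj
  -- The colour class of `i₀` has a point on the side of the origin, and `σ'` chooses it. Its hull
  -- still contains `z σ`, which would be the closest point for `σ'` as well.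
  set σ' := Function.update σ i₀ j with hσ'
  have hzσ' : z σ ∈ K σ' := by
    have h2 : z σ ∈ convexHull ℝ ((fun i => c i (σ i)) '' (T : Set ι)) :=
      zeroHull_sub_iff.1 (mem_convexHull_image_of_weights (fun i hi => (ha i hi).le) h1 h0)
    refine convexHull_mono ?_ h2
    rintro _ ⟨i, hi, rfl⟩
    refine ⟨i, by simp, ?_⟩
    have : i ≠ i₀ := by rintro rfl; exact hi₀ (by exact_mod_cast hi)
    simp [hσ', this]
  have hjσ' : c i₀ j ∈ K σ' := subset_convexHull ℝ _ ⟨i₀, by simp, by simp [hσ']⟩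
  have h3 := hσ σ' (Finset.mem_univ _)
  have h4 := hz σ' _ hzσ'
  have h5 : z σ' = z σ := by
    have h6 : ‖z σ' - z σ‖ ^ 2 ≤ 0 := by
      rw [norm_sub_sq_real]
      nlinarith [norm_nonneg (z σ), norm_nonneg (z σ')]
    have h7 : ‖z σ' - z σ‖ = 0 := by nlinarith [norm_nonneg (z σ' - z σ)]
    exact sub_eq_zero.1 (norm_eq_zero.1 h7)
  have h8 := hz σ' _ hjσ'
  rw [h5] at h8
  have : 0 < ‖z σ‖ := norm_pos_iff.2 hz0
  nlinarith

theorem colorful_caratheodory {ι J E : Type*} [Fintype ι] [Fintype J] [Nonempty J]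
    [NormedAddCommGroup E] [NormedSpace ℝ E] [FiniteDimensional ℝ E]
    (hι : finrank ℝ E < Fintype.card ι) (c : ι → J → E)
    (hc : ∀ i, ZeroHull (c i) Finset.univ) :
    ∃ σ : ι → J, ZeroHull (fun i => c i (σ i)) Finset.univ := by
  set L : E →ₗ[ℝ] EuclideanSpace ℝ (Fin (finrank ℝ E)) :=
    (toEuclidean (E := E)).toLinearEquiv.toLinearMap
  obtain ⟨σ, hσ⟩ := colorful_caratheodory_inner (by simpa using hι) (fun i j => L (c i j))
    fun i => (hc i).map L
  exact ⟨σ, hσ.of_injective_map L (toEuclidean (E := E)).injective⟩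

/-- Tverberg's theorem, deduced from the colourful Carathéodory theorem by Sarkaria's trick: the
`i`-th point gives the colour class of the tuples with the lifted point `(x i, 1)` in one of the `m`
places and zero in the others, translated by their mean. -/
theorem exists_tverberg_coloring {ι F : Type*} [Fintype ι] [NormedAddCommGroup F]
    [NormedSpace ℝ F] [FiniteDimensional ℝ F] {m : ℕ} (hm : 0 < m) (x : ι → F)
    (hι : (m - 1) * (finrank ℝ F + 1) < Fintype.card ι) :
    ∃ (c : ι → Fin m) (p : F), ∀ j, p ∈ convexHull ℝ (x '' {i | c i = j}) := by
  classical
  have : Nonempty (Fin m) := ⟨⟨0, hm⟩⟩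
  have hm0 : (m : ℝ) ≠ 0 := by exact_mod_cast hm.ne'
  -- The tuples with sum zero form a space of dimension `(m - 1) * (finrank ℝ F + 1)`.
  set Φ : (Fin m → F × ℝ) →ₗ[ℝ] F × ℝ := ∑ j, LinearMap.proj j with hΦ
  have hΦa : ∀ v, Φ v = ∑ j, v j := fun v => by simp [hΦ]
  set W := LinearMap.ker Φ with hW
  have hWfin : finrank ℝ W = (m - 1) * (finrank ℝ F + 1) := by
    have hsurj : LinearMap.range Φ = ⊤ := by
      rw [LinearMap.range_eq_top]
      intro v
      exact ⟨Pi.single ⟨0, hm⟩ v, by rw [hΦa, Finset.sum_pi_single']; simp⟩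
    have h1 := LinearMap.finrank_range_add_finrank_ker Φ
    rw [hsurj, finrank_top, finrank_pi_fintype, Finset.sum_const, Finset.card_univ,
      Fintype.card_fin, finrank_prod, finrank_self, smul_eq_mul, ← hW] at h1
    obtain ⟨r, rfl⟩ : ∃ r, m = r + 1 := ⟨m - 1, by omega⟩
    rw [Nat.add_sub_cancel]
    rw [Nat.succ_mul] at h1
    omega
  set y : ι → F × ℝ := fun i => (x i, 1) with hy
  set u : ι → Fin m → Fin m → F × ℝ := fun i j j' =>
    (if j' = j then y i else 0) - (m : ℝ)⁻¹ • y i with hu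
  have huW : ∀ i j, u i j ∈ W := by
    intro i j
    rw [hW, LinearMap.mem_ker, hΦa]
    simp only [hu, Finset.sum_sub_distrib, Finset.sum_ite_eq', Finset.mem_univ, if_true,
      Finset.sum_const, Finset.card_univ, Fintype.card_fin]
    rw [← Nat.cast_smul_eq_nsmul ℝ, smul_smul, mul_inv_cancel₀ hm0, one_smul, sub_self]
  obtain ⟨σ, hσ⟩ := colorful_caratheodory (E := W) (by rw [hWfin]; exact hι)
    (fun i j => ⟨u i j, huW i j⟩) fun i => by
      rw [zeroHull_iff_weights]
      refine ⟨fun _ => (m : ℝ)⁻¹, fun _ _ => by positivity, by simp [hm0], ?_⟩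
      refine Subtype.ext (funext fun j' => ?_)
      simp only [← Finset.smul_sum, Submodule.coe_smul, Submodule.coe_sum, Pi.smul_apply,
        Finset.sum_apply, Submodule.coe_zero, Pi.zero_apply]
      simp only [hu, Finset.sum_sub_distrib, Finset.sum_ite_eq, Finset.mem_univ, if_true,
        Finset.sum_const, Finset.card_univ, Fintype.card_fin]
      rw [← Nat.cast_smul_eq_nsmul ℝ, smul_smul, mul_inv_cancel₀ hm0, one_smul, sub_self, smul_zero]
  obtain ⟨a, ha, h1, h0⟩ := zeroHull_iff_weights.1 hσ
  -- The weighted sums of lifted points agree for all parts; the last coordinate shows that each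
  -- part has total weight `m⁻¹`, and the others give the common point.
  have hcoord : ∀ j, ∑ i ∈ Finset.univ.filter (fun i => σ i = j), a i • y i =
      (m : ℝ)⁻¹ • ∑ i, a i • y i := by
    intro j
    have h2 := congrFun (congrArg Subtype.val h0) j
    simp only [Submodule.coe_smul, Submodule.coe_sum, Pi.smul_apply,
      Finset.sum_apply, Submodule.coe_zero, Pi.zero_apply] at h2
    simp only [hu, smul_sub, Finset.sum_sub_distrib, smul_ite, smul_zero] at h2
    rw [Finset.sum_filter, Finset.smul_sum]
    exact (Finset.sum_congr rfl fun i _ => if_congr eq_comm rfl rfl).trans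
      ((sub_eq_zero.1 h2).trans (Finset.sum_congr rfl fun i _ => smul_comm _ _ _))
  refine ⟨σ, ∑ i, a i • x i, fun j => ?_⟩
  have hfst := congrArg Prod.fst (hcoord j)
  have hsnd := congrArg Prod.snd (hcoord j)
  simp only [Prod.fst_sum, Prod.snd_sum, Prod.smul_fst, Prod.smul_snd, hy, smul_eq_mul, mul_one,
    h1] at hfst hsnd
  have := mem_convexHull_image_of_weights (x := x)
    (T := Finset.univ.filter fun i => σ i = j) (a := fun i => m * a i) (p := ∑ i, a i • x i)
    (fun i _ => mul_nonneg (Nat.cast_nonneg m) (ha i (Finset.mem_univ i)))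
    (by rw [← Finset.mul_sum, hsnd, mul_inv_cancel₀ hm0])
    (by
      simp only [← smul_smul, ← Finset.smul_sum]
      rw [hfst, smul_smul, mul_inv_cancel₀ hm0, one_smul])
  simpa using this

end Tverberg

/-! ### Products with real space -/

section Product

open Module

/-- If every family of `N` points of `S'` splits around some point of `S'` into
`(m - 1) * (k + 1) + 1` parts, then any `N` points of `S' × ℝ^k` have an `m`-Tverberg partition:
choose a point above the common point in each part, and apply Tverberg's theorem in `ℝ^k` to these
points. -/
theorem tverbergNumber_prodReal_le {j k m N : ℕ} (hm : 0 < m) (hN : 0 < N)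
    {S' : Set (Fin j → ℝ)}
    (h : ∀ x : Fin N → Fin j → ℝ, (∀ i, x i ∈ S') →
      ∃ p ∈ S', Splits (fun i => x i - p) Finset.univ ((m - 1) * (k + 1) + 1)) :
    tverbergNumber (prodReal S' k) m ≤ (N : ℕ∞) := by
  classical
  refine iInf₂_le N ⟨hN, fun A hA hAS => ?_⟩
  obtain ⟨y, hy⟩ : ∃ y : Fin N → (Fin j → ℝ) × (Fin k → ℝ), A = ∑ i, {y i} := by
    have e : Fin N ≃ A := (Fintype.equivFinOfCardEq (by rw [Multiset.card_coe, hA])).symm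
    refine ⟨fun i => (e i).1, ?_⟩
    rw [e.sum_comp fun t : A => ({t.1} : Multiset ((Fin j → ℝ) × (Fin k → ℝ)))]
    have h1 : ∑ t : A, ({t.1} : Multiset ((Fin j → ℝ) × (Fin k → ℝ))) =
        ((Finset.univ.val.map fun t : A => t.1).map fun t => {t}).sum := by
      rw [Multiset.map_map]; rfl
    rw [h1, Multiset.sum_map_singleton, Multiset.map_univ_coe]
  subst hy
  have hyS : ∀ i, (y i).1 ∈ S' := fun i => by
    have := hAS (y i) (Multiset.mem_sum.2 ⟨i, Finset.mem_univ i, Multiset.mem_singleton_self _⟩)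
    exact this.1
  obtain ⟨p, hp, hsplit⟩ := h (fun i => (y i).1) hyS
  obtain ⟨c, hc⟩ := hsplit.exists_coloring
  set M := (m - 1) * (k + 1) + 1 with hM
  have hT : ∀ l : Fin M, ∃ s : Fin k → ℝ, (p, s) ∈ convexHull ℝ (y '' {i | c i = l}) := by
    intro l
    obtain ⟨T, -, hTc, h0⟩ := hc l l.2
    obtain ⟨a, ha, h1, h0⟩ := zeroHull_iff_weights.1 h0
    refine ⟨∑ i ∈ T, a i • (y i).2, convexHull_mono (Set.image_mono fun i hi => hTc i hi)
      (mem_convexHull_image_of_weights ha h1 (Prod.ext ?_ ?_))⟩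
    · simp only [smul_sub, Finset.sum_sub_distrib, ← Finset.sum_smul, h1, one_smul] at h0
      rw [Prod.fst_sum]
      exact sub_eq_zero.1 h0
    · rw [Prod.snd_sum]; rfl
  choose s hs using hT
  obtain ⟨d, q, hq⟩ := exists_tverberg_coloring hm s (by
    rw [finrank_fin_fun, Fintype.card_fin]; omega)
  -- Points in none of the `M` parts may join any part of the final partition.
  set c' : Fin N → Fin m := fun i => if hi : c i < M then d ⟨c i, hi⟩ else ⟨0, hm⟩ with hc'
  refine ⟨fun l => ∑ i ∈ Finset.univ.filter (fun i => c' i = l), {y i},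
    Finset.sum_fiberwise _ _ _, (p, q), Set.mem_iInter.2 fun l => ?_, hp, trivial⟩
  have hset : {e | e ∈ ∑ i ∈ Finset.univ.filter (fun i => c' i = l), ({y i} : Multiset _)} =
      y '' {i | c' i = l} := by
    ext e
    simp [Multiset.mem_sum, eq_comm]
  rw [hset]
  have hconv : Convex ℝ {t : Fin k → ℝ | (p, t) ∈ convexHull ℝ (y '' {i | c' i = l})} := by
    intro t ht t' ht' α β hα hβ hαβ
    have := convex_convexHull ℝ _ ht ht' hα hβ hαβ
    rwa [Prod.smul_mk, Prod.smul_mk, Prod.mk_add_mk, ← add_smul, hαβ, one_smul] at this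
  refine convexHull_min ?_ hconv (hq l)
  rintro _ ⟨r, hr, rfl⟩
  refine convexHull_mono (Set.image_mono fun i hi => ?_) (hs r)
  have hi' : c i = r := hi
  have hlt : c i < M := hi' ▸ r.2
  change c' i = l
  rw [hc']
  simp only [hlt, dif_pos]
  rw [← hr]
  congr 1
  exact Fin.ext hi'

end Product

/-! ### Planar sets with small Helly number -/

section SmallHelly

open Module

/-- A point around which a family has positive convex weights can be moved a little within the hull,
in every direction spanned by the family. -/
theorem eventually_add_smul_mem_convexHull {ι E : Type*} [AddCommGroup E] [Module ℝ E]
    {x : ι → E} {p u : E} {T : Finset ι} {a : ι → ℝ} (ha : ∀ i ∈ T, 0 < a i)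
    (h1 : ∑ i ∈ T, a i = 1) (h0 : ∑ i ∈ T, a i • (x i - p) = 0)
    (hu : u ∈ Submodule.span ℝ ((fun i => x i - p) '' (T : Set ι))) :
    ∀ᶠ ε : ℝ in nhdsWithin 0 (Set.Ioi 0), p + ε • u ∈ convexHull ℝ (x '' (T : Set ι)) := by
  obtain ⟨μ, hμ⟩ := (Submodule.mem_span_image_finset_iff_exists_fun' ℝ).1 hu
  have hev : ∀ᶠ ε : ℝ in nhdsWithin 0 (Set.Ioi 0), ∀ i ∈ T,
      0 < a i + ε * (μ i - (∑ l ∈ T, μ l) * a i) := by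
    rw [Filter.eventually_all_finset]
    intro i hi
    have hlim : Filter.Tendsto (fun ε : ℝ => a i + ε * (μ i - (∑ l ∈ T, μ l) * a i)) (nhds 0)
        (nhds (a i + 0 * (μ i - (∑ l ∈ T, μ l) * a i))) :=
      (by fun_prop : Continuous fun ε : ℝ =>
        a i + ε * (μ i - (∑ l ∈ T, μ l) * a i)).tendsto 0
    rw [zero_mul, add_zero] at hlim
    exact (hlim.mono_left nhdsWithin_le_nhds).eventually (lt_mem_nhds (ha i hi))
  filter_upwards [hev] with ε hε
  have hsum : ∑ i ∈ T, (a i + ε * (μ i - (∑ l ∈ T, μ l) * a i)) = 1 := by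
    rw [Finset.sum_add_distrib, ← Finset.mul_sum, Finset.sum_sub_distrib, ← Finset.mul_sum, h1]
    ring
  refine mem_convexHull_image_of_weights (fun i hi => (hε i hi).le) hsum ?_
  have hdiff : ∑ i ∈ T, (a i + ε * (μ i - (∑ l ∈ T, μ l) * a i)) • (x i - p) = ε • u := by
    have : ∀ i ∈ T, (a i + ε * (μ i - (∑ l ∈ T, μ l) * a i)) • (x i - p) =
        (1 - ε * ∑ l ∈ T, μ l) • (a i • (x i - p)) + ε • (μ i • (x i - p)) := by
      intro i _
      rw [smul_smul, smul_smul, ← add_smul]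
      congr 1
      ring
    rw [Finset.sum_congr rfl this, Finset.sum_add_distrib, ← Finset.smul_sum, ← Finset.smul_sum,
      h0, smul_zero, zero_add, hμ]
  rw [← hdiff]
  simp only [smul_sub, Finset.sum_sub_distrib]
  rw [← Finset.sum_smul, hsum, one_smul]
  abel

theorem le_of_mem_convexHull {E : Type*} [AddCommGroup E] [Module ℝ E] (f : E →ₗ[ℝ] ℝ) {s : Set E}
    {r : ℝ} (hs : ∀ y ∈ s, f y ≤ r) {z : E} (hz : z ∈ convexHull ℝ s) : f z ≤ r :=
  convexHull_min (t := {y | f y ≤ r}) hs (convex_halfSpace_le f.isLinear r) hz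

variable {S' : Set (Fin 2 → ℝ)} {h : ℕ}

/-- A Helly bound of `n` provides, for each `n + 1` points of the set, a point of the set in all
hulls of `n` of them. -/
theorem IsHellyBound.exists_mem_hulls {E : Type*} [AddCommGroup E] [Module ℝ E] {S : Set E}
    {h n : ℕ} (hS : IsHellyBound S h) (hn : h ≤ n) (y : Fin (n + 1) → E) (hy : ∀ i, y i ∈ S) :
    ∃ s ∈ S, ∀ i, s ∈ convexHull ℝ (y '' {i}ᶜ) := by
  obtain ⟨s, hs, hsS⟩ := hS.inter_nonempty Finset.univ (fun i => convexHull ℝ (y '' {i}ᶜ))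
    (fun i _ => convex_convexHull ℝ _) fun J _ hJ => by
      obtain ⟨i, hi⟩ : ∃ i, i ∉ J := by
        by_contra! hall
        rw [Finset.eq_univ_iff_forall.2 hall, Finset.card_univ, Fintype.card_fin] at hJ
        omega
      refine ⟨y i, Set.mem_iInter₂.2 fun l hl => subset_convexHull ℝ _ ⟨i, ?_, rfl⟩, hy i⟩
      rintro rfl
      exact hi hl
  exact ⟨s, hsS, fun i => Set.mem_iInter₂.1 hs i (Finset.mem_univ i)⟩

/-- A planar set with Helly bound three contains the crossing points of segments between its
points. -/
theorem IsHellyBound.crossing_mem (hS : IsHellyBound S' h) (hh : h ≤ 3) {p u v : Fin 2 → ℝ}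
    (huv : LinearIndependent ℝ ![u, v]) {α β γ δ : ℝ} (hα : 0 < α) (hβ : 0 < β) (hγ : 0 < γ)
    (hδ : 0 < δ) (h1 : p + α • u ∈ S') (h2 : p - β • u ∈ S') (h3 : p + γ • v ∈ S')
    (h4 : p - δ • v ∈ S') : p ∈ S' := by
  obtain ⟨s, hsS, hs⟩ := hS.exists_mem_hulls hh ![p + α • u, p - β • u, p + γ • v, p - δ • v]
    (by simp [Fin.forall_fin_succ, h1, h2, h3, h4])
  set b : Basis (Fin 2) ℝ (Fin 2 → ℝ) :=
    basisOfLinearIndependentOfCardEqFinrank huv (by simp) with hb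
  have hb0 : b 0 = u := by simp [hb]
  have hb1 : b 1 = v := by simp [hb]
  have c00 : b.coord 0 u = 1 := by rw [← hb0]; simp
  have c01 : b.coord 0 v = 0 := by rw [← hb1]; simp
  have c10 : b.coord 1 u = 0 := by rw [← hb0]; simp
  have c11 : b.coord 1 v = 1 := by rw [← hb1]; simp
  have key : ∀ (f : (Fin 2 → ℝ) →ₗ[ℝ] ℝ) (i : Fin 4), (∀ l, l ≠ i →
      f (![p + α • u, p - β • u, p + γ • v, p - δ • v] l) ≤ f p) → f s ≤ f p := by
    intro f i hf
    refine le_of_mem_convexHull f ?_ (hs i)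
    rintro _ ⟨l, hl, rfl⟩
    exact hf l hl
  have k0 := key (b.coord 0) 0 (by
    simp [Fin.forall_fin_succ, -Basis.coord_apply, map_add, map_sub, c00, c01, hβ.le])
  have k1 := key (-b.coord 0) 1 (by
    simp [Fin.forall_fin_succ, -Basis.coord_apply, map_add, map_sub, c00, c01, hα.le])
  have k2 := key (b.coord 1) 2 (by
    simp [Fin.forall_fin_succ, -Basis.coord_apply, map_add, map_sub, c10, c11, hδ.le])
  have k3 := key (-b.coord 1) 3 (by
    simp [Fin.forall_fin_succ, -Basis.coord_apply, map_add, map_sub, c10, c11, hγ.le])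
  rw [LinearMap.neg_apply, LinearMap.neg_apply, neg_le_neg_iff] at k1 k3
  have : s = p := by
    refine b.ext_elem fun i => ?_
    fin_cases i
    · exact le_antisymm k0 k1
    · exact le_antisymm k2 k3
  exact this ▸ hsS

/-- A planar set with Helly bound two is contained in a line. -/
theorem IsHellyBound.not_linearIndependent (hS : IsHellyBound S' h) (hh : h ≤ 2)
    {p a b : Fin 2 → ℝ} (hp : p ∈ S') (ha : a ∈ S') (hb : b ∈ S') :
    ¬ LinearIndependent ℝ ![a - p, b - p] := by
  intro hind
  obtain ⟨s, -, hs⟩ := hS.exists_mem_hulls hh ![p, a, b]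
    (by simp [Fin.forall_fin_succ, hp, ha, hb])
  set e : Basis (Fin 2) ℝ (Fin 2 → ℝ) :=
    basisOfLinearIndependentOfCardEqFinrank hind (by simp) with he
  have he0 : e 0 = a - p := by simp [he]
  have he1 : e 1 = b - p := by simp [he]
  have c0a : e.coord 0 a - e.coord 0 p = 1 := by rw [← map_sub, ← he0]; simp
  have c0b : e.coord 0 b - e.coord 0 p = 0 := by rw [← map_sub, ← he1]; simp
  have c1a : e.coord 1 a - e.coord 1 p = 0 := by rw [← map_sub, ← he0]; simp
  have c1b : e.coord 1 b - e.coord 1 p = 1 := by rw [← map_sub, ← he1]; simp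
  have key : ∀ (f : (Fin 2 → ℝ) →ₗ[ℝ] ℝ) (r : ℝ) (i : Fin 3),
      (∀ l, l ≠ i → f (![p, a, b] l) ≤ r) → f s ≤ r := by
    intro f r i hf
    refine le_of_mem_convexHull f ?_ (hs i)
    rintro _ ⟨l, hl, rfl⟩
    exact hf l hl
  have k0 := key (-(e.coord 0 + e.coord 1)) (-(e.coord 0 p + e.coord 1 p + 1)) 0 (by
    simp only [Fin.forall_fin_succ, LinearMap.neg_apply, LinearMap.add_apply]
    refine ⟨fun h => absurd rfl h, fun _ => ?_, fun _ => ?_, fun i => i.elim0⟩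
    · change -(e.coord 0 a + e.coord 1 a) ≤ _; linarith
    · change -(e.coord 0 b + e.coord 1 b) ≤ _; linarith)
  have k1 := key (e.coord 0) (e.coord 0 p) 1 (by
    simp only [Fin.forall_fin_succ]
    refine ⟨fun _ => le_rfl, fun h => absurd rfl h, fun _ => ?_, fun i => i.elim0⟩
    change e.coord 0 b ≤ _; linarith)
  have k2 := key (e.coord 1) (e.coord 1 p) 2 (by
    simp only [Fin.forall_fin_succ]
    refine ⟨fun _ => le_rfl, fun _ => ?_, fun h => absurd rfl h, fun i => i.elim0⟩
    change e.coord 1 a ≤ _; linarith)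
  rw [LinearMap.neg_apply, LinearMap.add_apply] at k0
  linarith

/-- For a planar set with Helly bound three, an extreme point of the intersection of the hulls in a
Tverberg partition belongs to the set: it is one of the points, or two edges cross there. -/
theorem IsHellyBound.exists_splits_of_le_three {ι : Type*} [Fintype ι] [DecidableEq ι]
    (hS : IsHellyBound S' h) (hh : h ≤ 3) {M : ℕ} (hM : 0 < M) {x : ι → Fin 2 → ℝ}
    (hx : ∀ i, x i ∈ S') (hι : (M - 1) * 3 < Fintype.card ι) :
    ∃ p ∈ S', Splits (fun i => x i - p) Finset.univ M := by
  obtain ⟨c, p₀, hp₀⟩ := exists_tverberg_coloring hM x (by rwa [finrank_fin_fun])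
  set T : Fin M → Finset ι := fun j => Finset.univ.filter fun i => c i = j with hT
  have hTset : ∀ j, (T j : Set ι) = {i | c i = j} := fun j => by simp [hT]
  set P : Set (Fin 2 → ℝ) := ⋂ j, convexHull ℝ (x '' (T j : Set ι)) with hP
  have hcomp : ∀ j, IsCompact (convexHull ℝ (x '' (T j : Set ι))) := fun j =>
    ((T j).finite_toSet.image x).isCompact_convexHull ℝ
  have hPc : IsCompact P := by
    refine (hcomp ⟨0, hM⟩).of_isClosed_subset (isClosed_iInter fun j => (hcomp j).isClosed) ?_
    exact Set.iInter_subset _ _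
  obtain ⟨p, hp⟩ := hPc.extremePoints_nonempty
    ⟨p₀, Set.mem_iInter.2 fun j => by rw [hTset]; exact hp₀ j⟩
  have hpP := Set.mem_iInter.1 (extremePoints_subset hp)
  have hsplit : Splits (fun i => x i - p) Finset.univ M := by
    refine Splits.of_family (T := fun n => Finset.univ.filter fun i => (c i : ℕ) = n)
      (fun n hn => ?_) (fun a _ b _ hab => ?_) fun _ _ => Finset.subset_univ _
    · refine (zeroHull_sub_iff.2 (hpP ⟨n, hn⟩)).mono fun i hi => ?_
      rw [hT, Finset.mem_filter] at hi
      rw [Finset.mem_filter]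
      exact ⟨Finset.mem_univ _, by rw [hi.2]⟩
    · rw [Finset.disjoint_left]
      intro i hi hi'
      exact hab ((Finset.mem_filter.1 hi).2.symm.trans (Finset.mem_filter.1 hi').2)
  refine ⟨p, ?_, hsplit⟩
  have hwt := fun j => (zeroHull_sub_iff.2 (hpP j)).exists_pos_weights
  choose R hRT a ha h1 h0 _ using hwt
  set V : Fin M → Submodule ℝ (Fin 2 → ℝ) := fun j =>
    Submodule.span ℝ ((fun i => x i - p) '' (R j : Set ι)) with hV
  -- Directions common to all faces vanish, as `p` is extreme.
  have hzero : ∀ u, (∀ j, u ∈ V j) → u = 0 := by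
    intro u hu
    have hev : ∀ᶠ ε : ℝ in nhdsWithin 0 (Set.Ioi 0), (∀ j, p + ε • u ∈
        convexHull ℝ (x '' (T j : Set ι))) ∧ ∀ j, p + ε • (-u) ∈
        convexHull ℝ (x '' (T j : Set ι)) := by
      refine Filter.Eventually.and (Filter.eventually_all.2 fun j => ?_)
        (Filter.eventually_all.2 fun j => ?_)
      · filter_upwards [eventually_add_smul_mem_convexHull (ha j) (h1 j) (h0 j) (hu j)] with ε hε
        exact convexHull_mono (Set.image_mono (by exact_mod_cast hRT j)) hε
      · filter_upwards [eventually_add_smul_mem_convexHull (ha j) (h1 j) (h0 j)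
          ((V j).neg_mem (hu j))] with ε hε
        exact convexHull_mono (Set.image_mono (by exact_mod_cast hRT j)) hε
    obtain ⟨ε, ⟨hε1, hε2⟩, hε⟩ := (hev.and self_mem_nhdsWithin).exists
    replace hε : 0 < ε := hε
    have hseg : p ∈ openSegment ℝ (p + ε • u) (p + ε • (-u)) := by
      refine ⟨1 / 2, 1 / 2, by norm_num, by norm_num, by norm_num, ?_⟩
      rw [smul_neg, ← smul_add, add_add_add_comm, add_neg_cancel, add_zero, ← two_smul ℝ p,
        smul_smul]
      norm_num
    have := hp.2 (Set.mem_iInter.2 hε1) (Set.mem_iInter.2 hε2) hseg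
    have h2 : ε • u = 0 := by simpa using this
    exact (smul_eq_zero.1 h2).resolve_left hε.ne'
  by_cases hbot : ∃ j, V j = ⊥
  · obtain ⟨j, hj⟩ := hbot
    obtain ⟨i, hi⟩ : (R j).Nonempty := by
      by_contra hemp
      have := h1 j
      rw [Finset.not_nonempty_iff_eq_empty.1 hemp, Finset.sum_empty] at this
      exact zero_ne_one this
    have := (Submodule.span_eq_bot.1 hj) _ ⟨i, by exact_mod_cast hi, rfl⟩
    rw [← sub_eq_zero.1 this]
    exact hx i
  push Not at hbot
  have hline : ∀ j, V j ≠ ⊤ → finrank ℝ (V j) = 1 := by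
    intro j hj
    have h2 := Submodule.finrank_lt hj
    rw [finrank_fin_fun] at h2
    have h3 : finrank ℝ (V j) ≠ 0 := fun h => hbot j (Submodule.finrank_eq_zero.1 h)
    omega
  -- On a line, there are points on both sides of `p`.
  have hsides : ∀ j, V j ≠ ⊤ → ∃ u, V j = Submodule.span ℝ {u} ∧ u ≠ 0 ∧ ∃ α β : ℝ, 0 < α ∧
      0 < β ∧ p + α • u ∈ S' ∧ p - β • u ∈ S' := by
    intro j hj
    obtain ⟨u, hu0, hu⟩ := finrank_eq_one_iff'.1 (hline j hj)
    have hu0' : u.1 ≠ 0 := fun h => hu0 (Subtype.ext h)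
    have hall : ∀ i, ∃ t : ℝ, i ∈ R j → x i - p = t • u.1 := by
      intro i
      by_cases hi : i ∈ R j
      · obtain ⟨t, ht⟩ := hu ⟨x i - p, Submodule.subset_span ⟨i, by exact_mod_cast hi, rfl⟩⟩
        exact ⟨t, fun _ => (congrArg Subtype.val ht).symm⟩
      · exact ⟨0, fun h => absurd h hi⟩
    choose t ht using hall
    have hVu : V j = Submodule.span ℝ {u.1} := by
      refine le_antisymm (fun v hv => ?_) ((Submodule.span_singleton_le_iff_mem _ _).2 u.2)
      obtain ⟨r, hr⟩ := hu ⟨v, hv⟩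
      exact Submodule.mem_span_singleton.2 ⟨r, congrArg Subtype.val hr⟩
    have hsum : ∑ i ∈ R j, a j i * t i = 0 := by
      have h2 := h0 j
      have h3 : ∑ i ∈ R j, a j i • (x i - p) = (∑ i ∈ R j, a j i * t i) • u.1 := by
        rw [Finset.sum_smul]
        exact Finset.sum_congr rfl fun i hi => by rw [ht i hi, smul_smul]
      rw [h3] at h2
      exact (smul_eq_zero.1 h2).resolve_right hu0'
    have hne : ∃ i ∈ R j, a j i * t i ≠ 0 := by
      by_contra! hall
      refine hbot j (Submodule.span_eq_bot.2 ?_)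
      rintro _ ⟨i, hi, rfl⟩
      have hi' : i ∈ R j := by exact_mod_cast hi
      have := (mul_eq_zero.1 (hall i hi')).resolve_left (ha j i hi').ne'
      simp only
      rw [ht i hi', this, zero_smul]
    obtain ⟨i, hi, hipos⟩ := Finset.exists_pos_of_sum_zero_of_exists_nonzero _ hsum hne
    obtain ⟨i', hi', hneg⟩ := Finset.exists_pos_of_sum_zero_of_exists_nonzero
      (fun i => -(a j i * t i)) (by rw [Finset.sum_neg_distrib, hsum, neg_zero])
      (by obtain ⟨l, hl, hl0⟩ := hne; exact ⟨l, hl, neg_ne_zero.2 hl0⟩)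
    refine ⟨u.1, hVu, hu0', t i, -t i', (mul_pos_iff_of_pos_left (ha j i hi)).1 hipos, ?_, ?_, ?_⟩
    · rw [← mul_neg] at hneg
      exact (mul_pos_iff_of_pos_left (ha j i' hi')).1 hneg
    · rw [← ht i hi, add_sub_cancel]; exact hx i
    · rw [neg_smul, sub_neg_eq_add, ← ht i' hi', add_sub_cancel]; exact hx i'
  obtain ⟨j, hj⟩ : ∃ j, V j ≠ ⊤ := by
    by_contra! htop
    have := hzero (fun _ => 1) fun j => by rw [htop j]; trivial
    exact one_ne_zero (congrFun this 0)
  obtain ⟨u, hVu, hu0, α, β, hα, hβ, hm1, hm2⟩ := hsides j hj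
  obtain ⟨j', hj'⟩ : ∃ j', u ∉ V j' := by
    by_contra! hall
    exact hu0 (hzero u hall)
  obtain ⟨v, hVv, hv0, γ, δ, hγ, hδ, hm3, hm4⟩ := hsides j' fun htop => hj' (htop ▸ trivial)
  refine hS.crossing_mem hh ?_ hα hβ hγ hδ hm1 hm2 hm3 hm4
  rw [LinearIndependent.pair_symm_iff, LinearIndependent.pair_iff' hv0]
  intro r hr
  exact hj' (hVv ▸ Submodule.mem_span_singleton.2 ⟨r, hr⟩)

/-- `h * r + 1` points of a planar set with Helly bound `h` split around a point of the set into
`r + 1` parts. For `h ≥ 4` and `r ≥ 2` there are at least `3 * (r + 1)` points, so that a point of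
depth `r + 1` is good enough. -/
theorem IsHellyBound.exists_splits_plane {ι : Type*} [Fintype ι] [DecidableEq ι]
    (hS : IsHellyBound S' h) {r : ℕ} (hr : 2 ≤ r) {x : ι → Fin 2 → ℝ}
    (hx : ∀ i, x i ∈ S') (hι : Fintype.card ι = h * r + 1) :
    ∃ p ∈ S', Splits (fun i => x i - p) Finset.univ (r + 1) := by
  obtain ⟨p, hp, hdeep⟩ := hS.exists_deep (D := r) hx (by omega)
  rcases Nat.lt_or_ge 3 h with h4 | h3
  · refine ⟨p, hp, Deep.splits_plane _ rfl hdeep ?_⟩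
    rw [Finset.card_univ, hι]
    have := Nat.mul_le_mul_right r h4
    omega
  rcases Nat.lt_or_ge 2 h with h2 | h2
  · refine hS.exists_splits_of_le_three h3 (by omega) hx ?_
    have : h = 3 := by omega
    subst this
    omega
  -- With Helly bound two the set lies on a line, where depth `r + 1` gives `r + 1` parts.
  · refine ⟨p, hp, Deep.splits (d := 1) (by norm_num) ?_ (by simpa using hdeep)⟩
    by_cases hall : ∀ i, x i - p = 0
    · have : Submodule.span ℝ ((fun i => x i - p) '' ((Finset.univ : Finset ι) : Set ι)) = ⊥ := by
        rw [Submodule.span_eq_bot]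
        rintro _ ⟨i, -, rfl⟩
        exact hall i
      rw [this]
      simp
    push Not at hall
    obtain ⟨i₀, hi₀⟩ := hall
    have hle : Submodule.span ℝ ((fun i => x i - p) '' ((Finset.univ : Finset ι) : Set ι)) ≤
        Submodule.span ℝ {x i₀ - p} := by
      rw [Submodule.span_le]
      rintro _ ⟨i, -, rfl⟩
      have := hS.not_linearIndependent h2 hp (hx i₀) (hx i)
      rw [LinearIndependent.pair_iff' hi₀] at this
      push Not at this
      exact Submodule.mem_span_singleton.2 this
    exact (Submodule.finrank_mono hle).trans (finrank_span_singleton hi₀).le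

end SmallHelly

/-! ### The lower bound -/

section LowerBound

/-- The vertices of the product of the unit cube with the standard simplex. -/
noncomputable def cubeSimplexVertex (j k : ℕ) (v : (Fin j → Bool) × Option (Fin k)) :
    (Fin j → ℝ) × (Fin k → ℝ) :=
  (fun i => if v.1 i then 1 else 0, v.2.elim 0 fun l => Pi.single l 1)

/-- The barycentric coordinate of a point of `ℝ^k` at a vertex of the standard simplex, where `none`
stands for the origin. -/
noncomputable def simplexCoord {k : ℕ} (o : Option (Fin k)) (t : Fin k → ℝ) : ℝ :=
  o.elim (1 - ∑ l, t l) fun l => t l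

theorem simplexCoord_vertex {k : ℕ} (o o' : Option (Fin k)) :
    simplexCoord o (o'.elim 0 fun l => Pi.single l 1) = if o = o' then 1 else 0 := by
  rcases o with _ | l <;> rcases o' with _ | l' <;> simp [simplexCoord, Pi.single_apply]

theorem simplexCoord_combo {k : ℕ} (o : Option (Fin k)) (t t' : Fin k → ℝ) {a b : ℝ}
    (hab : a + b = 1) :
    simplexCoord o (a • t + b • t') = a * simplexCoord o t + b * simplexCoord o t' := by
  rcases o with _ | l
  · simp only [simplexCoord, Option.elim_none, Pi.add_apply, Pi.smul_apply, smul_eq_mul,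
      Finset.sum_add_distrib, ← Finset.mul_sum]
    linear_combination -hab
  · simp [simplexCoord]

theorem exists_simplexCoord_pos {k : ℕ} (t : Fin k → ℝ) : ∃ o, 0 < simplexCoord o t := by
  by_contra! hle
  have h1 := hle none
  have h2 := Finset.sum_nonpos fun (l : Fin k) (_ : l ∈ Finset.univ) => hle (some l)
  simp only [simplexCoord, Option.elim_none, Option.elim_some] at h1 h2
  linarith

/-- In a Tverberg partition of vertices of the product of cube and simplex, with common point in
`ℤ^j × ℝ^k`, some vertex belongs to all parts: the integral coordinates of the common point are
those of a vertex of the cube, and one of its barycentric coordinates is positive. -/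
theorem exists_vertex_mem_all {j k m : ℕ} (hm : 0 < m)
    {P : Fin m → Multiset ((Fin j → ℝ) × (Fin k → ℝ))}
    (hP : ∀ l, ∀ e ∈ P l, ∃ v, cubeSimplexVertex j k v = e)
    (h : ((⋂ l, convexHull ℝ {e | e ∈ P l}) ∩ prodReal (integerLattice j) k).Nonempty) :
    ∃ v, ∀ l, cubeSimplexVertex j k v ∈ P l := by
  obtain ⟨⟨s, t⟩, hst, hs, -⟩ := h
  have hst := fun l => Set.mem_iInter.1 hst l
  have hs01 : ∀ i, s i = 0 ∨ s i = 1 := by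
    intro i
    have hconv : Convex ℝ {e : (Fin j → ℝ) × (Fin k → ℝ) | e.1 i ∈ Set.Icc (0 : ℝ) 1} := by
      intro e he e' he' a b ha hb hab
      exact convex_Icc (0 : ℝ) 1 he he' ha hb hab
    have hmem : s i ∈ Set.Icc (0 : ℝ) 1 := convexHull_min (fun e he => by
      obtain ⟨v, rfl⟩ := hP ⟨0, hm⟩ e he
      change (if v.1 i then (1 : ℝ) else 0) ∈ Set.Icc (0 : ℝ) 1
      split_ifs <;> simp) hconv (hst ⟨0, hm⟩)
    obtain ⟨z, hz⟩ := hs i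
    change s i = z at hz
    rw [hz] at hmem ⊢
    have h0 : (0 : ℤ) ≤ z := by exact_mod_cast hmem.1
    have h1 : z ≤ (1 : ℤ) := by exact_mod_cast hmem.2
    rcases (by omega : z = 0 ∨ z = 1) with rfl | rfl <;> simp
  obtain ⟨o, ho⟩ := exists_simplexCoord_pos t
  set β : Fin j → Bool := fun i => decide (s i = 1) with hβ
  -- An affine function that is nonpositive at all vertices but one, and positive at `(s, t)`.
  set G : (Fin j → ℝ) × (Fin k → ℝ) → ℝ := fun e =>
    simplexCoord o e.2 - ∑ i, (if β i then 1 - e.1 i else e.1 i) with hG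
  have hGst : 0 < G (s, t) := by
    have : ∑ i, (if β i then 1 - s i else s i) = 0 := by
      refine Finset.sum_eq_zero fun i _ => ?_
      rcases hs01 i with h | h <;> simp [hβ, h]
    simpa [hG, this] using ho
  have hGconv : Convex ℝ {e | G e ≤ 0} := by
    intro e he e' he' a b ha hb hab
    have : G (a • e + b • e') = a * G e + b * G e' := by
      simp only [hG, Prod.snd_add, Prod.smul_snd, Prod.fst_add, Prod.smul_fst,
        simplexCoord_combo o _ _ hab]
      rw [mul_sub, mul_sub, Finset.mul_sum, Finset.mul_sum, sub_add_sub_comm,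
        ← Finset.sum_add_distrib]
      congr 1
      refine Finset.sum_congr rfl fun i _ => ?_
      simp only [Pi.add_apply, Pi.smul_apply, smul_eq_mul]
      split_ifs
      · linear_combination -hab
      · rfl
    change G _ ≤ 0
    rw [this]
    exact add_nonpos (mul_nonpos_of_nonneg_of_nonpos ha he) (mul_nonpos_of_nonneg_of_nonpos hb he')
  refine ⟨(β, o), fun l => ?_⟩
  by_contra hl
  refine absurd (convexHull_min (fun e he => ?_) hGconv (hst l)) (not_le.2 hGst)
  obtain ⟨⟨β', o'⟩, rfl⟩ := hP l e he
  have hterm : ∀ i ∈ Finset.univ, 0 ≤ (if β i then 1 - (if β' i then (1 : ℝ) else 0)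
      else (if β' i then (1 : ℝ) else 0)) := by
    intro i _
    split_ifs <;> norm_num
  have hGv : G (cubeSimplexVertex j k (β', o')) = (if o = o' then 1 else 0) -
      ∑ i, (if β i then 1 - (if β' i then (1 : ℝ) else 0) else (if β' i then (1 : ℝ) else 0)) := by
    rw [← simplexCoord_vertex]
    rfl
  change G _ ≤ 0
  rw [hGv]
  by_cases ho' : o = o'
  · have hne : β' ≠ β := by
      rintro rfl
      exact hl (ho' ▸ he)
    obtain ⟨i, hi⟩ := Function.ne_iff.1 hne
    have h1 := Finset.single_le_sum hterm (Finset.mem_univ i)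
    have h2 : (if β i then 1 - (if β' i then (1 : ℝ) else 0)
        else (if β' i then (1 : ℝ) else 0)) = 1 := by
      rcases hb : β i <;> rcases hb' : β' i <;> simp_all
    rw [h2] at h1
    rw [if_pos ho']
    linarith
  · rw [if_neg ho']
    linarith [Finset.sum_nonneg hterm]

theorem cubeSimplexVertex_injective (j k : ℕ) : Function.Injective (cubeSimplexVertex j k) := by
  rintro ⟨β, o⟩ ⟨β', o'⟩ h
  have h1 := congrArg Prod.fst h
  have h2 := congrArg Prod.snd h
  refine Prod.ext (funext fun i => ?_) ?_
  · have := congrFun h1 i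
    simp only [cubeSimplexVertex] at this
    rcases hb : β i <;> rcases hb' : β' i <;> simp_all
  · by_contra hne
    have h3 := congrArg (simplexCoord o) h2
    simp only [cubeSimplexVertex] at h3
    rw [simplexCoord_vertex, simplexCoord_vertex, if_pos rfl, if_neg hne] at h3
    exact one_ne_zero h3

/-- The vertices of the product of cube and simplex, each taken `m - 1` times, have no `m`-Tverberg
partition over `ℤ^j × ℝ^k`. -/
theorem le_tverbergNumber_integerLattice {m : ℕ} (hm : 0 < m) (j k : ℕ) :
    ((2 ^ j * (m - 1) * (k + 1) + 1 : ℕ) : ℕ∞) ≤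
      tverbergNumber (prodReal (integerLattice j) k) m := by
  classical
  refine le_iInf₂ fun n hn => Nat.cast_le.2 ?_
  by_contra hlt
  set V : Multiset ((Fin j → ℝ) × (Fin k → ℝ)) :=
    Finset.univ.val.map (cubeSimplexVertex j k) with hV
  have hVcard : V.card = 2 ^ j * (k + 1) := by
    rw [hV, Multiset.card_map]
    change (Finset.univ : Finset ((Fin j → Bool) × Option (Fin k))).card = _
    simp
  -- The bound is needed for every smaller number `n` of points, since having a Tverberg partition
  -- for `n` points is not assumed to persist for more: any `n` of these vertices will do.
  obtain ⟨A, hA⟩ : ∃ A, A ∈ Multiset.powersetCard n ((m - 1) • V) := by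
    refine Multiset.card_pos_iff_exists_mem.1 ?_
    rw [Multiset.card_powersetCard, Multiset.card_nsmul, hVcard]
    refine Nat.choose_pos ?_
    have : 2 ^ j * (m - 1) * (k + 1) = (m - 1) * (2 ^ j * (k + 1)) := by ring
    omega
  obtain ⟨hAV, hAcard⟩ := Multiset.mem_powersetCard.1 hA
  have hAv : ∀ e ∈ A, ∃ v, cubeSimplexVertex j k v = e := by
    intro e he
    have := Multiset.mem_of_mem_nsmul (Multiset.mem_of_le hAV he)
    obtain ⟨v, -, hv⟩ := Multiset.mem_map.1 this
    exact ⟨v, hv⟩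
  obtain ⟨P, hPA, hP⟩ := hn.2 A hAcard fun e he => by
    obtain ⟨v, rfl⟩ := hAv e he
    refine ⟨fun i => ⟨if v.1 i then 1 else 0, ?_⟩, trivial⟩
    simp only [cubeSimplexVertex]
    split_ifs <;> simp
  have hPle : ∀ l, P l ≤ A := fun l => hPA ▸ Finset.single_le_sum (fun _ _ => Multiset.zero_le _)
    (Finset.mem_univ l)
  obtain ⟨v, hv⟩ := exists_vertex_mem_all hm
    (fun l e he => hAv e (Multiset.mem_of_le (hPle l) he)) hP
  -- The vertex common to all `m` parts would have multiplicity at least `m`.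
  have h1 : m ≤ A.count (cubeSimplexVertex j k v) := by
    rw [← hPA, Multiset.count_sum']
    calc m = ∑ _l : Fin m, 1 := by simp
      _ ≤ _ := Finset.sum_le_sum fun l _ => Multiset.one_le_count_iff_mem.2 (hv l)
  have h2 := Multiset.count_le_of_le (cubeSimplexVertex j k v) hAV
  have h3 : V.count (cubeSimplexVertex j k v) ≤ 1 :=
    Multiset.nodup_iff_count_le_one.1
      (Finset.univ.nodup.map (cubeSimplexVertex_injective j k)) _
  rw [Multiset.count_nsmul] at h2
  have h4 := Nat.mul_le_mul_left (m - 1) h3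
  omega

end LowerBound

/-! ### Mixed integer Tverberg numbers -/

section MixedInteger

open Module

theorem tverbergNumber_integerLattice_le {j k m : ℕ} (hj : 0 < j) (hm : 0 < m) :
    tverbergNumber (prodReal (integerLattice j) k) m ≤
      ((j * 2 ^ j * (m - 1) * (k + 1) + 1 : ℕ) : ℕ∞) := by
  refine tverbergNumber_prodReal_le hm (Nat.succ_pos _) fun x hx => ?_
  obtain ⟨p, hp, hdeep⟩ := (isHellyBound_integerLattice j).exists_deep
    (D := j * ((m - 1) * (k + 1))) hx (by
      rw [Fintype.card_fin]
      refine Nat.lt_succ_of_le (le_of_eq ?_)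
      ring)
  exact ⟨p, hp, hdeep.splits hj ((Submodule.finrank_le _).trans (by simp))⟩

theorem tverbergNumber_integerLattice_three_le {k m : ℕ} (hk : 1 ≤ k) (hm : 2 ≤ m) :
    tverbergNumber (prodReal (integerLattice 3) k) m ≤
      ((24 * (m - 1) * (k + 1) - 7 : ℕ) : ℕ∞) := by
  have hr : 2 ≤ (m - 1) * (k + 1) :=
    (by omega : 2 ≤ 1 * (k + 1)).trans (Nat.mul_le_mul_right _ (by omega))
  rw [mul_assoc]
  refine tverbergNumber_prodReal_le (by omega) (by omega) fun x hx => ?_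
  -- With `(m - 1) * (k + 1) = s + 1` there are `24 * s + 17 = 8 * (3 * s + 2) + 1` points, enough
  -- for a point of depth `3 * (s + 1)`, and at least `37 + 4 * s` as `s ≥ 1`.
  obtain ⟨s, hs⟩ : ∃ s, (m - 1) * (k + 1) = s + 1 := ⟨(m - 1) * (k + 1) - 1, by omega⟩
  obtain ⟨p, hp, hdeep⟩ := (isHellyBound_integerLattice 3).exists_deep (D := 3 * s + 2) hx (by
    rw [Fintype.card_fin]
    omega)
  refine ⟨p, hp, ?_⟩
  rw [show (m - 1) * (k + 1) + 1 = s + 2 by omega]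
  refine Deep.splits_add_two (by simp) (s := s) ?_ ?_
  · exact hdeep
  · rw [Finset.card_univ, Fintype.card_fin]
    omega

/-- For a planar set, the Helly number bounds the Tverberg number of its product with `ℝ^k`. -/
theorem IsHellyBound.tverbergNumber_plane_le {S' : Set (Fin 2 → ℝ)} {h k m : ℕ}
    (hS : IsHellyBound S' h) (hk : 1 ≤ k) (hm : 2 ≤ m) :
    tverbergNumber (prodReal S' k) m ≤ ((h * (m - 1) * (k + 1) + 1 : ℕ) : ℕ∞) := by
  have hr : 2 ≤ (m - 1) * (k + 1) :=
    (by omega : 2 ≤ 1 * (k + 1)).trans (Nat.mul_le_mul_right _ (by omega))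
  refine tverbergNumber_prodReal_le (by omega) (Nat.succ_pos _) fun x hx => ?_
  exact hS.exists_splits_plane hr hx (by rw [Fintype.card_fin, mul_assoc])

end MixedInteger

theorem mainTheorem6 :
    ∀ m k : ℕ, 2 ≤ m → 1 ≤ k →
      -- general mixed integer bounds
      (∀ j : ℕ, 1 ≤ j →
        ((2 ^ j * (m - 1) * (k + 1) + 1 : ℕ) : ℕ∞)
            ≤ tverbergNumber (prodReal (integerLattice j) k) m ∧
        tverbergNumber (prodReal (integerLattice j) k) m
            ≤ ((j * 2 ^ j * (m - 1) * (k + 1) + 1 : ℕ) : ℕ∞)) ∧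
      -- exact values for one and two integer coordinates
      tverbergNumber (prodReal (integerLattice 1) k) m
          = ((2 * (m - 1) * (k + 1) + 1 : ℕ) : ℕ∞) ∧
      tverbergNumber (prodReal (integerLattice 2) k) m
          = ((4 * (m - 1) * (k + 1) + 1 : ℕ) : ℕ∞) ∧
      -- three integer coordinates
      tverbergNumber (prodReal (integerLattice 3) k) m
          ≤ ((24 * (m - 1) * (k + 1) - 7 : ℕ) : ℕ∞) ∧
      -- planar sets with finite Helly number
      (∀ S' : Set (Fin 2 → ℝ), hellyNumber S' < ⊤ →
        tverbergNumber (prodReal S' k) m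
          ≤ hellyNumber S' * ((m - 1 : ℕ) : ℕ∞) * ((k + 1 : ℕ) : ℕ∞) + 1) := by
  intro m k hm hk
  have hm0 : 0 < m := by omega
  refine ⟨fun j hj => ⟨le_tverbergNumber_integerLattice hm0 j k,
    tverbergNumber_integerLattice_le hj hm0⟩, ?_, ?_,
    tverbergNumber_integerLattice_three_le hk hm, fun S' hS' => ?_⟩
  · exact le_antisymm (tverbergNumber_integerLattice_le Nat.one_pos hm0)
      (le_tverbergNumber_integerLattice hm0 1 k)
  · exact le_antisymm ((isHellyBound_integerLattice 2).tverbergNumber_plane_le hk hm)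
      (le_tverbergNumber_integerLattice hm0 2 k)
  · obtain ⟨h, hh, heq⟩ := exists_isHellyBound_of_lt_top hS'
    rw [heq]
    exact_mod_cast hh.tverbergNumber_plane_le hk hm
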